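/- Let $\mathcal B$ and $\mathcal C$ be (not necessarily unital) $C^*$-algebras, let $E$ be a (right) Hilbert $\mathcal B$-module and let $F$ be a (right) Hilbert $\mathcal C$-module. Write $\mathscr B^a(F,G)$ for the adjointable operators $F\to G$ between Hilbert $\mathcal C$-modules, $\mathscr B^a(E)=\mathscr B^a(E,E)$, and $\mathscr K(E)$ for the norm closure in $\mathscr B^a(E)$ of the linear span of the operators $xy^*\colon z\mapsto x\langle y,z\rangle$ ($x,y\in E$). A net $(a_\lambda)$ in $\mathscr B^a(E)$ converges strictly to $a$ if $\|a_\lambda k-ak\|\to0$ and $\|ka_\lambda-ka\|\to0$ for all $k\in\mathscr K(E)$ (likewise for $F$). Let $\mathfrak T\colon\mathscr B^a(E)\to\mathscr B^a(F)$ be a completely positive linear map that is strict, that is, it sends bounded strictly convergent nets in $\mathscr B^a(E)$ to strictly convergent nets in $\mathscr B^a(F)$. Then there exist a $\mathcal B$-$\mathcal C$ correspondence $\mathfrak F$ (a Hilbert $\mathcal C$-module with a nondegenerate $*$-homomorphism $\mathcal B\to\mathscr B^a(\mathfrak F)$ as left action) and an operator $\Xi\in\mathscr B^a(F,E\odot\mathfrak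 F)$ such that $$\mathfrak T(a)=\Xi^*(a\odot\mathrm{id}_{\mathfrak F})\,\Xi\qquad\text{for all }a\in\mathscr B^a(E).$$ Here $E\odot\mathfrak F$ is the interior tensor product, i.e. the Hilbert $\mathcal C$-module spanned topologically by elements $x\odot y$ with $\langle x\odot y,x'\odot y'\rangle=\langle y,\langle x,x'\rangle y'\rangle$, and $a\odot\mathrm{id}_{\mathfrak F}$ is the adjointable operator $x\odot y\mapsto ax\odot y$. -/

import Mathlib

/-- The opposite of an ordered C⋆-algebra is star-ordered (the order being the same one). A right
module over `B` is a left module over `Bᵐᵒᵖ`. -/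
instance MulOpposite.instStarOrderedRingOfCStar {B : Type*} [NonUnitalCStarAlgebra B]
    [PartialOrder B] [StarOrderedRing B] : StarOrderedRing Bᵐᵒᵖ := by
  refine StarOrderedRing.of_nonneg_iff' (fun {x y} h z ↦ ?_) (fun x ↦ ?_)
  · exact MulOpposite.unop_le_unop.mp (by simpa using MulOpposite.unop_le_unop.mpr h)
  · rw [← MulOpposite.unop_le_unop, MulOpposite.unop_zero,
      CStarAlgebra.nonneg_iff_eq_mul_star_self]
    constructor
    · rintro ⟨y, hy⟩
      exact ⟨MulOpposite.op y, MulOpposite.unop_injective (by simpa using hy)⟩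
    · rintro ⟨y, rfl⟩
      exact ⟨y.unop, by simp⟩

universe u v w w'

set_option linter.unusedSectionVars false

noncomputable section

namespace HilbertCStar

/-! ## Adjointable operators between Hilbert modules

A complex Hilbert module over `A` in the sense of Mathlib is a complete `CStarModule A E`, where `A`
acts by `a • x` and `⟪x, a • y⟫ = a * ⟪x, y⟫`. A (right) Hilbert `B`-module, with
`⟪x, y b⟫ = ⟪x, y⟫ b`, is thus a complete `CStarModule Bᵐᵒᵖ E`, with `x b = op b • x`. -/

section Adjointable

variable (A E F G : Type*) [NonUnitalCStarAlgebra A] [PartialOrder A]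
  [NormedAddCommGroup E] [NormedSpace ℂ E] [SMul A E] [CStarModule A E]
  [NormedAddCommGroup F] [NormedSpace ℂ F] [SMul A F] [CStarModule A F]
  [NormedAddCommGroup G] [NormedSpace ℂ G] [SMul A G] [CStarModule A G]

/-- `𝓑ᵃ(E, F)`: the space of maps `f : E → F` that have an adjoint `g : F → E`,
`⟪f x, y⟫ = ⟪x, g y⟫`. -/
def Adjointable : Submodule ℂ (E →L[ℂ] F) where
  carrier := {f | ∃ g : F →L[ℂ] E, ∀ x y, inner A (f x) y = inner A x (g y)}
  add_mem' := by
    rintro f f' ⟨g, hg⟩ ⟨g', hg'⟩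
    exact ⟨g + g', fun x y ↦ by simp [hg, hg']⟩
  zero_mem' := ⟨0, fun x y ↦ by simp⟩
  smul_mem' := by
    rintro c f ⟨g, hg⟩
    exact ⟨star c • g, fun x y ↦ by simp [hg]⟩

variable {A E F G}

lemma ext_inner_left {x y : E} (h : ∀ z : E, inner A z x = inner A z y) : x = y := by
  have h0 : inner A (x - y) (x - y) = 0 := by
    rw [CStarModule.inner_sub_right, h, sub_self]
  exact sub_eq_zero.mp (CStarModule.inner_self.mp h0)

namespace Adjointable

/-- The adjoint `f* ∈ 𝓑ᵃ(F, E)` of `f ∈ 𝓑ᵃ(E, F)`. -/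
def adj (f : Adjointable A E F) : Adjointable A F E :=
  ⟨f.2.choose, f.1, fun x y ↦ by
    rw [← CStarModule.star_inner y, ← f.2.choose_spec y x, CStarModule.star_inner]⟩

lemma inner_adj_right (f : Adjointable A E F) (x : E) (y : F) :
    inner A x ((adj f).1 y) = inner A (f.1 x) y := (f.2.choose_spec x y).symm

lemma inner_adj_left (f : Adjointable A E F) (x : E) (y : F) :
    inner A ((adj f).1 y) x = inner A y (f.1 x) := by
  rw [← CStarModule.star_inner x, inner_adj_right, CStarModule.star_inner]

lemma eq_adj {f : Adjointable A E F} {g : Adjointable A F E}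
    (h : ∀ x y, inner A (f.1 x) y = inner A x (g.1 y)) : g = adj f := by
  refine Subtype.ext (ContinuousLinearMap.ext fun y ↦ ext_inner_left (A := A) fun x ↦ ?_)
  rw [← h, inner_adj_right]

/-- An adjointable operator is determined by its values. -/
lemma ext' {f g : Adjointable A E F} (h : ∀ x, f.1 x = g.1 x) : f = g :=
  Subtype.ext (ContinuousLinearMap.ext h)

instance : Mul (Adjointable A E E) where
  mul f g := ⟨f.1 * g.1, (adj g).1 * (adj f).1, fun x y ↦ by
    simp [inner_adj_right]⟩

instance : One (Adjointable A E E) where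
  one := ⟨1, 1, fun x y ↦ by simp⟩

@[simp] lemma coe_mul (f g : Adjointable A E E) : (f * g).1 = f.1 * g.1 := rfl

@[simp] lemma coe_one : (1 : Adjointable A E E).1 = 1 := rfl

instance : Ring (Adjointable A E E) where
  __ := (inferInstance : AddCommGroup (Adjointable A E E))
  left_distrib a b c := Subtype.ext (mul_add a.1 b.1 c.1)
  right_distrib a b c := Subtype.ext (add_mul a.1 b.1 c.1)
  zero_mul a := Subtype.ext (zero_mul a.1)
  mul_zero a := Subtype.ext (mul_zero a.1)
  mul_assoc a b c := Subtype.ext (mul_assoc a.1 b.1 c.1)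
  one_mul a := Subtype.ext (one_mul a.1)
  mul_one a := Subtype.ext (mul_one a.1)

instance : NormedRing (Adjointable A E E) where
  __ := (inferInstance : NormedAddCommGroup (Adjointable A E E))
  __ := (inferInstance : Ring (Adjointable A E E))
  norm_mul_le a b := norm_mul_le a.1 b.1

instance : Algebra ℂ (Adjointable A E E) :=
  Algebra.ofModule (fun c a b ↦ Subtype.ext (smul_mul_assoc c a.1 b.1))
    (fun c a b ↦ Subtype.ext (mul_smul_comm c a.1 b.1))

instance : NormedAlgebra ℂ (Adjointable A E E) where
  norm_smul_le c a := norm_smul_le c a.1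

instance : StarRing (Adjointable A E E) where
  star := adj
  star_involutive f := (eq_adj fun x y ↦ inner_adj_left f y x).symm
  star_mul f g := (eq_adj fun x y ↦ by simp [inner_adj_right]).symm
  star_add f g := (eq_adj fun x y ↦ by simp [inner_adj_right]).symm

lemma star_def (f : Adjointable A E E) : star f = adj f := rfl

instance : StarModule ℂ (Adjointable A E E) where
  star_smul c f := (eq_adj fun x y ↦ by simp [star_def, inner_adj_right]).symm

variable [StarOrderedRing A]

lemma norm_sq_le (f : Adjointable A E F) : ‖f‖ * ‖f‖ ≤ ‖(adj f).1 ∘L f.1‖ := by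
  have h : ‖f.1‖ ≤ √‖(adj f).1 ∘L f.1‖ := by
    refine ContinuousLinearMap.opNorm_le_bound _ (Real.sqrt_nonneg _) fun x ↦ ?_
    rw [← Real.sqrt_sq (norm_nonneg x), ← Real.sqrt_mul (norm_nonneg _)]
    refine Real.le_sqrt_of_sq_le ?_
    calc ‖f.1 x‖ ^ 2 = ‖inner A x (((adj f).1 ∘L f.1) x)‖ := by
          rw [CStarModule.norm_sq_eq A]; simp [inner_adj_right]
      _ ≤ ‖x‖ * ‖((adj f).1 ∘L f.1) x‖ := CStarModule.norm_inner_le E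
      _ ≤ ‖x‖ * (‖(adj f).1 ∘L f.1‖ * ‖x‖) := by gcongr; exact ContinuousLinearMap.le_opNorm _ _
      _ = _ := by ring
  calc ‖f‖ * ‖f‖ = ‖f.1‖ * ‖f.1‖ := rfl
    _ ≤ √‖(adj f).1 ∘L f.1‖ * √‖(adj f).1 ∘L f.1‖ := by gcongr
    _ = _ := Real.mul_self_sqrt (norm_nonneg _)

lemma norm_adj_le (f : Adjointable A E F) : ‖f‖ ≤ ‖adj f‖ := by
  rcases (norm_nonneg f).eq_or_lt with h | h
  · rw [← h]; exact norm_nonneg _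
  · refine le_of_mul_le_mul_right ((norm_sq_le f).trans ?_) h
    exact ContinuousLinearMap.opNorm_comp_le _ _

instance : CStarRing (Adjointable A E E) where
  norm_mul_self_le f := norm_sq_le f

instance [CompleteSpace E] : CompleteSpace (Adjointable A E E) := by
  refine Metric.complete_of_cauchySeq_tendsto fun u hu ↦ ?_
  have hu' : CauchySeq fun n ↦ (u n).1 :=
    uniformContinuous_subtype_val.comp_cauchySeq hu
  have hv' : CauchySeq fun n ↦ (adj (u n)).1 := by
    refine uniformContinuous_subtype_val.comp_cauchySeq (u := fun n ↦ adj (u n)) ?_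
    refine Metric.cauchySeq_iff.mpr fun ε hε ↦ ?_
    obtain ⟨N, hN⟩ := Metric.cauchySeq_iff.mp hu ε hε
    refine ⟨N, fun m hm n hn ↦ ?_⟩
    rw [dist_eq_norm, ← star_def, ← star_def, ← star_sub, norm_star, ← dist_eq_norm]
    exact hN m hm n hn
  obtain ⟨f, hf⟩ := cauchySeq_tendsto_of_complete hu'
  obtain ⟨g, hg⟩ := cauchySeq_tendsto_of_complete hv'
  refine ⟨⟨f, g, fun x y ↦ ?_⟩, ?_⟩
  · have h1 : Filter.Tendsto (fun n ↦ inner A ((u n).1 x) y) Filter.atTop (nhds (inner A (f x) y)) :=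
      (CStarModule.continuous_inner.comp (Continuous.prodMk_left y)).continuousAt.tendsto.comp
        ((ContinuousLinearMap.apply ℂ E x).continuous.continuousAt.tendsto.comp hf)
    have h2 : Filter.Tendsto (fun n ↦ inner A x ((adj (u n)).1 y)) Filter.atTop
        (nhds (inner A x (g y))) :=
      (CStarModule.continuous_inner.comp (Continuous.prodMk_right x)).continuousAt.tendsto.comp
        ((ContinuousLinearMap.apply ℂ E y).continuous.continuousAt.tendsto.comp hg)
    simp only [inner_adj_right] at h2
    exact tendsto_nhds_unique h1 h2
  · exact tendsto_subtype_rng.mpr hf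

/-- `𝓑ᵃ(E)` is a unital C⋆-algebra. -/
instance [CompleteSpace E] : CStarAlgebra (Adjointable A E E) where

/-- The order of the C⋆-algebra `𝓑ᵃ(E)`. -/
instance [CompleteSpace E] : PartialOrder (Adjointable A E E) := CStarAlgebra.spectralOrder _

instance [CompleteSpace E] : StarOrderedRing (Adjointable A E E) :=
  CStarAlgebra.spectralOrderedRing _

end Adjointable

end Adjointable

/-! ## Completion of a semi-Hilbert module -/

/-- A semi-Hilbert module: the axioms of `CStarModule` without the requirement that
`⟪x, x⟫ = 0` only for `x = 0`. -/
class SemiCStarModule (A V : Type*) [NonUnitalCStarAlgebra A] [PartialOrder A]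
    [AddCommGroup V] [Module ℂ V] [SMul A V] [Norm V] extends Inner A V where
  inner_add_right' {x y z : V} : inner x (y + z) = inner x y + inner x z
  inner_self_nonneg' {x : V} : 0 ≤ inner x x
  inner_smul_right' {a : A} {x y : V} : inner x (a • y) = a * inner x y
  inner_smul_right_complex' {c : ℂ} {x y : V} : inner x (c • y) = c • inner x y
  star_inner' (x y : V) : star (inner x y) = inner y x
  norm_eq' (x : V) : ‖x‖ = √‖inner x x‖

namespace SemiCStarModule

section Core

variable {A V : Type*} [NonUnitalCStarAlgebra A] [PartialOrder A]
  [AddCommGroup V] [Module ℂ V] [SMul A V] [Norm V] [SemiCStarModule A V]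

variable (A V) in
/-- The inner product as a sesquilinear map. -/
def innerLin : V →ₗ⋆[ℂ] V →ₗ[ℂ] A :=
  LinearMap.mk₂'ₛₗ (starRingEnd ℂ) (RingHom.id ℂ) (fun x y ↦ inner A x y)
    (fun x y z ↦ by
      rw [← star_inner', inner_add_right', star_add, star_inner', star_inner'])
    (fun c x y ↦ by
      rw [← star_inner', inner_smul_right_complex', star_smul, star_inner']; rfl)
    (fun x y z ↦ inner_add_right') (fun c x y ↦ inner_smul_right_complex')

lemma innerLin_apply (x y : V) : innerLin A V x y = inner A x y := rfl

lemma inner_smul_left' (a : A) (x y : V) : inner A (a • x) y = inner A x y * star a := by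
  rw [← star_inner', inner_smul_right', star_mul, star_inner']

lemma norm_sq' (x : V) : ‖x‖ ^ 2 = ‖inner A x x‖ := by
  rw [norm_eq' (A := A), Real.sq_sqrt (norm_nonneg _)]

variable [StarOrderedRing A]

lemma norm_inner_le' (x y : V) : ‖inner A x y‖ ≤ ‖x‖ * ‖y‖ := by
  have key : ∀ s : ℝ, ‖x‖ ^ 2 < s → ‖inner A x y‖ ^ 2 ≤ s * ‖y‖ ^ 2 := by
    intro s hs
    have hs0 : 0 < s := (sq_nonneg _).trans_lt hs
    set a : A := inner A x y with ha
    have hstar : star a = inner A y x := star_inner' _ _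
    have h0 : 0 ≤ innerLin A V (a • x - (s : ℂ) • y) (a • x - (s : ℂ) • y) := by
      rw [innerLin_apply]; exact inner_self_nonneg'
    have h1 : innerLin A V (a • x - (s : ℂ) • y) (a • x - (s : ℂ) • y)
        = a * inner A x x * star a - s • (a * star a) - s • (a * star a)
          + s • (s • inner A y y) := by
      simp only [map_sub, LinearMap.sub_apply, map_smulₛₗ, LinearMap.smul_apply, innerLin_apply,
        inner_smul_right', inner_smul_left', Complex.conj_ofReal, RingHom.id_apply]
      rw [← ha, ← hstar]
      simp only [Complex.coe_smul, mul_assoc, smul_sub]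
      abel
    have h2 : a * inner A x x * star a ≤ s • (a * star a) :=
      calc a * inner A x x * star a ≤ ‖inner A x x‖ • (a * star a) :=
            CStarAlgebra.star_right_conjugate_le_norm_smul
              (hb := by exact (star_inner' x x : IsSelfAdjoint (inner A x x)))
        _ ≤ s • (a * star a) := by
            rw [← norm_sq']
            exact smul_le_smul_of_nonneg_right hs.le (mul_star_self_nonneg a)
    have h3 : s • (a * star a) ≤ s • (s • inner A y y) := by
      rw [h1] at h0
      have : 0 ≤ s • (a * star a) - s • (a * star a) - s • (a * star a)
          + s • (s • inner A y y) := by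
        refine h0.trans ?_
        gcongr
      rw [sub_self, zero_sub, le_neg_add_iff_add_le, add_zero] at this
      exact this
    rw [smul_le_smul_iff_of_pos_left hs0] at h3
    have h4 := CStarAlgebra.norm_le_norm_of_nonneg_of_le (mul_star_self_nonneg a) h3
    rw [CStarRing.norm_self_mul_star, norm_smul, ← norm_sq', Real.norm_of_nonneg hs0.le,
      ← pow_two] at h4
    exact h4
  have h : ‖inner A x y‖ ^ 2 ≤ (‖x‖ * ‖y‖) ^ 2 := by
    rw [mul_pow]
    refine le_of_forall_pos_le_add fun ε hε ↦ ?_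
    have hy : 0 < ‖y‖ ^ 2 + 1 := by positivity
    refine (key (‖x‖ ^ 2 + ε / (‖y‖ ^ 2 + 1)) (by linarith [div_pos hε hy])).trans ?_
    have : ε / (‖y‖ ^ 2 + 1) * ‖y‖ ^ 2 ≤ ε := by
      rw [div_mul_eq_mul_div, div_le_iff₀ hy]
      nlinarith
    linarith [add_mul (‖x‖ ^ 2) (ε / (‖y‖ ^ 2 + 1)) (‖y‖ ^ 2)]
  have hn : ∀ z : V, 0 ≤ ‖z‖ := fun z ↦ by rw [norm_eq' (A := A)]; exact Real.sqrt_nonneg _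
  exact (pow_le_pow_iff_left₀ (norm_nonneg _) (mul_nonneg (hn x) (hn y)) two_ne_zero).mp h

lemma core (A V : Type*) [NonUnitalCStarAlgebra A] [PartialOrder A] [StarOrderedRing A]
    [AddCommGroup V] [Module ℂ V] [SMul A V] [Norm V] [SemiCStarModule A V] :
    SeminormedSpace.Core ℂ V where
  norm_nonneg x := by rw [norm_eq' (A := A)]; exact Real.sqrt_nonneg _
  norm_smul c x := by
    rw [norm_eq' (A := A), norm_eq' (A := A) x, ← innerLin_apply]
    simp only [map_smulₛₗ, LinearMap.smul_apply, innerLin_apply, norm_smul, ← mul_assoc,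
      RingHom.id_apply, RCLike.norm_conj]
    rw [ Real.sqrt_mul (by positivity),
      Real.sqrt_mul_self (norm_nonneg _)]
  norm_triangle x y := by
    have hn : ∀ z : V, 0 ≤ ‖z‖ := fun z ↦ by rw [norm_eq' (A := A)]; exact Real.sqrt_nonneg _
    refine (pow_le_pow_iff_left₀ (hn _) (add_nonneg (hn x) (hn y)) two_ne_zero).mp ?_
    rw [norm_sq' (A := A), ← innerLin_apply]
    simp only [map_add, LinearMap.add_apply, innerLin_apply]
    calc _ ≤ ‖inner A x x‖ + ‖inner A y x‖ + (‖inner A x y‖ + ‖inner A y y‖) :=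
          (norm_add_le _ _).trans (add_le_add (norm_add_le _ _) (norm_add_le _ _))
      _ ≤ ‖x‖ ^ 2 + ‖y‖ * ‖x‖ + (‖x‖ * ‖y‖ + ‖y‖ ^ 2) := by
          rw [norm_sq' (A := A), norm_sq' (A := A)]
          gcongr <;> exact norm_inner_le' _ _
      _ = _ := by ring

end Core

section Completion

open UniformSpace

variable {A V : Type*} [NonUnitalCStarAlgebra A] [PartialOrder A]
  [SeminormedAddCommGroup V] [NormedSpace ℂ V] [SMul A V] [SemiCStarModule A V]

lemma norm_smul_sub_le (a : A) (x y : V) : ‖a • x - a • y‖ ≤ ‖a‖ * ‖x - y‖ := by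
  have h1 : ∀ w : V, inner A w (a • x - a • y) = a * inner A w (x - y) := fun w ↦ by
    rw [← innerLin_apply, map_sub, innerLin_apply, innerLin_apply, inner_smul_right',
      inner_smul_right', ← mul_sub, ← innerLin_apply, ← innerLin_apply, ← map_sub]
    rfl
  have h : ‖a • x - a • y‖ ^ 2 ≤ (‖a‖ * ‖x - y‖) ^ 2 := by
    rw [norm_sq' (A := A), h1, ← star_inner', h1, star_mul, star_inner', mul_pow,
      norm_sq' (A := A) (x - y), ← mul_assoc]
    calc _ ≤ ‖a‖ * ‖inner A (x - y) (x - y)‖ * ‖star a‖ :=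
          (norm_mul_le _ _).trans (by gcongr; exact norm_mul_le _ _)
      _ = _ := by rw [norm_star]; ring
  exact (pow_le_pow_iff_left₀ (norm_nonneg _) (by positivity) two_ne_zero).mp h

variable (A V) in
lemma uniformContinuousConstSMul : UniformContinuousConstSMul A V where
  uniformContinuous_const_smul a :=
    (LipschitzWith.of_dist_le_mul (K := ‖a‖₊) fun x y ↦ by
      simpa [dist_eq_norm] using norm_smul_sub_le a x y).uniformContinuous

variable [StarOrderedRing A]

variable (A V) in
lemma continuous_inner' : Continuous (fun p : V × V ↦ inner A p.1 p.2) := by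
  let f : V →L⋆[ℂ] V →L[ℂ] A := LinearMap.mkContinuous₂ (innerLin A V) 1 fun x y ↦ by
    simpa [innerLin_apply] using norm_inner_le' (A := A) x y
  have : Continuous fun p : V × V ↦ f p.1 p.2 := by fun_prop
  exact this

lemma inner_coe (x y : V) : inner A (x : Completion V) (y : Completion V) = inner A x y :=
  (Completion.isDenseInducing_coe.prodMap Completion.isDenseInducing_coe).extend_eq
    (continuous_inner' A V) (x, y)

variable (A V) in
lemma continuous_inner_completion :
    Continuous (fun p : Completion V × Completion V ↦ inner A p.1 p.2) := by
  let inner' : V →+ V →+ A := AddMonoidHom.mk' (fun x ↦ (innerLin A V x).toAddMonoidHom)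
    (fun x y ↦ by ext z; simp)
  have h : Continuous fun p : V × V ↦ inner' p.1 p.2 := continuous_inner' A V
  exact (Completion.isDenseInducing_toCompl V).extend_Z_bilin
    (Completion.isDenseInducing_toCompl V) h

/-- The Hilbert module obtained from a semi-Hilbert module by Hausdorff completion; the inner
product and the module action are the continuous extensions (the action being uniformly
continuous). -/
instance instCompletion [UniformContinuousConstSMul A V] : CStarModule A (Completion V) := by
  have hc {X : Type _} [TopologicalSpace X] {f g : X → Completion V} (hf : Continuous f)
      (hg : Continuous g) : Continuous fun t ↦ inner A (f t) (g t) :=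
    (continuous_inner_completion A V).comp (hf.prodMk hg)
  have hnorm (x : Completion V) : ‖x‖ = √‖inner A x x‖ := by
    induction x using Completion.induction_on with
    | hp => exact isClosed_eq continuous_norm (hc continuous_id continuous_id).norm.sqrt
    | ih x => rw [Completion.norm_coe, inner_coe, norm_eq' (A := A)]
  have hadd (x y z : Completion V) : inner A x (y + z) = inner A x y + inner A x z := by
    induction x, y, z using Completion.induction_on₃ with
    | hp => exact isClosed_eq (hc (by fun_prop) (by fun_prop))
              ((hc (by fun_prop) (by fun_prop)).add (hc (by fun_prop) (by fun_prop)))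
    | ih x y z => rw [← Completion.coe_add, inner_coe, inner_coe, inner_coe, inner_add_right']
  refine
    { inner_add_right := hadd _ _ _
      inner_self_nonneg := fun {x} ↦ ?_
      inner_self := fun {x} ↦ ⟨fun h ↦ ?_, ?_⟩
      inner_op_smul_right := fun {a x y} ↦ ?_
      inner_smul_right_complex := fun {c x y} ↦ ?_
      star_inner := fun x y ↦ ?_
      norm_eq_sqrt_norm_inner_self := hnorm }
  · induction x using Completion.induction_on with
    | hp => exact CStarAlgebra.isClosed_nonneg.preimage (hc continuous_id continuous_id)
    | ih x => rw [inner_coe]; exact inner_self_nonneg'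
  · rw [← norm_eq_zero, hnorm, h, norm_zero, Real.sqrt_zero]
  · rintro rfl
    simpa using hadd 0 0 0
  · induction x, y using Completion.induction_on₂ with
    | hp => exact isClosed_eq (hc (by fun_prop) (continuous_snd.const_smul a))
              ((hc (by fun_prop) (by fun_prop)).const_mul a)
    | ih x y => rw [← Completion.coe_smul, inner_coe, inner_coe, inner_smul_right']
  · induction x, y using Completion.induction_on₂ with
    | hp => exact isClosed_eq (hc (by fun_prop) (continuous_snd.const_smul c))
              ((hc (by fun_prop) (by fun_prop)).const_smul c)
    | ih x y => rw [← Completion.coe_smul, inner_coe, inner_coe, inner_smul_right_complex']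
  · induction x, y using Completion.induction_on₂ with
    | hp => exact isClosed_eq (hc (by fun_prop) (by fun_prop)).star (hc (by fun_prop) (by fun_prop))
    | ih x y => rw [inner_coe, inner_coe, star_inner']

end Completion

end SemiCStarModule

/-! ## Compact operators and the strict topology -/

section Strict

variable {A E F : Type*} [NonUnitalCStarAlgebra A] [PartialOrder A]
  [NormedAddCommGroup E] [NormedSpace ℂ E] [SMul A E] [CStarModule A E]
  [NormedAddCommGroup F] [NormedSpace ℂ F] [SMul A F] [CStarModule A F]

variable (E) in
/-- The module action of `a : A` on a Hilbert module, as a linear map. -/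
def smulLin (a : A) : E →ₗ[ℂ] E where
  toFun x := a • x
  map_add' x y := ext_inner_left (A := A) fun z ↦ by simp [mul_add]
  map_smul' c x := ext_inner_left (A := A) fun z ↦ by simp [mul_smul_comm]

lemma add_smul_mod (a b : A) (x : E) : (a + b) • x = a • x + b • x :=
  ext_inner_left (A := A) fun z ↦ by simp [add_mul]

lemma smul_smul_mod (c : ℂ) (a : A) (x : E) : (c • a) • x = c • (a • x) :=
  ext_inner_left (A := A) fun z ↦ by simp [smul_mul_assoc]

lemma norm_smul_mod_le (a : A) (x : E) : ‖a • x‖ ≤ ‖a‖ * ‖x‖ := by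
  refine (pow_le_pow_iff_left₀ (norm_nonneg _) (by positivity) two_ne_zero).mp ?_
  rw [CStarModule.norm_sq_eq A, mul_pow, CStarModule.norm_sq_eq A (x := x), CStarModule.inner_op_smul_right,
    CStarModule.inner_op_smul_left]
  calc _ ≤ ‖a‖ * (‖inner A x x‖ * ‖star a‖) :=
        (norm_mul_le _ _).trans (by gcongr; exact norm_mul_le _ _)
    _ = _ := by rw [norm_star]; ring

variable [StarOrderedRing A]

/-- The rank-one operator `x y* : F → E`, `z ↦ x ⟪y, z⟫`. -/
def rankOneCLM (x : E) (y : F) : F →L[ℂ] E :=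
  LinearMap.mkContinuous
    { toFun := fun z ↦ inner A y z • x
      map_add' := fun z w ↦ by rw [CStarModule.inner_add_right, add_smul_mod]
      map_smul' := fun c z ↦ by
        rw [CStarModule.inner_smul_right_complex, smul_smul_mod]; rfl }
    (‖x‖ * ‖y‖) fun z ↦ by
      refine (norm_smul_mod_le _ _).trans ?_
      calc ‖inner A y z‖ * ‖x‖ ≤ ‖y‖ * ‖z‖ * ‖x‖ := by
            gcongr; exact CStarModule.norm_inner_le F
        _ = _ := by ring

variable (A) in
/-- The rank-one operator `x y* ∈ 𝓑ᵃ(F, E)`, `z ↦ x ⟪y, z⟫`. -/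
def rankOne (x : E) (y : F) : Adjointable A F E :=
  ⟨rankOneCLM (A := A) x y, rankOneCLM (A := A) y x, fun z w ↦ by simp [rankOneCLM]⟩

lemma rankOne_apply (x : E) (y z : F) : (rankOne A x y).1 z = inner A y z • x := rfl

variable (A E) in
/-- `𝓚(E)`: the compact operators, the closed linear span of the rank-one operators in `𝓑ᵃ(E)`. -/
def compactOps : Submodule ℂ (Adjointable A E E) :=
  (Submodule.span ℂ {k | ∃ x y : E, k = rankOne A x y}).topologicalClosure

/-- Convergence in the strict topology of `𝓑ᵃ(E)`, the topology generated by the seminorms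
`a ↦ ‖a k‖` and `a ↦ ‖k a‖`, `k ∈ 𝓚(E)`. -/
def StrictTendsto {ι : Type*} (f : ι → Adjointable A E E) (l : Filter ι)
    (a : Adjointable A E E) : Prop :=
  ∀ k ∈ compactOps A E, Filter.Tendsto (fun i ↦ f i * k) l (nhds (a * k)) ∧
    Filter.Tendsto (fun i ↦ k * f i) l (nhds (k * a))

/-- A map is strict if it sends bounded strictly convergent filters (equivalently, nets) to
strictly convergent ones. (Comparing the filter `l` with `l ⊔ pure a`, one sees that the limit `b`
is then `T a`.) -/
def IsStrict {A' E' : Type*} [NonUnitalCStarAlgebra A'] [PartialOrder A'] [StarOrderedRing A']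
    [NormedAddCommGroup E'] [NormedSpace ℂ E'] [SMul A' E'] [CStarModule A' E']
    (T : Adjointable A E E → Adjointable A' E' E') : Prop :=
  ∀ (l : Filter (Adjointable A E E)) (r : ℝ) (a : Adjointable A E E),
    (∀ᶠ x in l, ‖x‖ ≤ r) → StrictTendsto id l a → ∃ b, StrictTendsto T l b

end Strict

/-! ## Correspondences -/

/-- A `B`-`C` correspondence: a (right) Hilbert `C`-module with a nondegenerate left action of `B`,
that is, a `*`-homomorphism from `B` into the adjointable operators such that the vectors `b y` span
a dense subspace. -/
structure Correspondence (B : Type u) (C : Type v) [NonUnitalCStarAlgebra B] [NonUnitalCStarAlgebra C]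
    [PartialOrder C] [StarOrderedRing C] where
  /-- The underlying Hilbert module. -/
  carrier : Type w
  [normedAddCommGroup : NormedAddCommGroup carrier]
  [normedSpace : NormedSpace ℂ carrier]
  [smul : SMul Cᵐᵒᵖ carrier]
  [cstarModule : CStarModule Cᵐᵒᵖ carrier]
  [completeSpace : CompleteSpace carrier]
  /-- The left action. -/
  leftAction : B →⋆ₙₐ[ℂ] Adjointable Cᵐᵒᵖ carrier carrier
  nondegenerate : (Submodule.span ℂ {z : carrier | ∃ b y, z = (leftAction b).1 y}).topologicalClosure
    = ⊤

attribute [instance] Correspondence.normedAddCommGroup Correspondence.normedSpace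
  Correspondence.smul Correspondence.cstarModule Correspondence.completeSpace

/-! ## Positivity of Gram matrices -/

section Gram

variable {n B E : Type*} [NonUnitalCStarAlgebra B] [PartialOrder B] [StarOrderedRing B]

open scoped CStarAlgebra

lemma exists_eq_star_mul_self {b : B} (hb : 0 ≤ b) : ∃ c, b = star c * c :=
  CStarAlgebra.nonneg_iff_eq_star_mul_self.mp hb

/-- A self-adjoint element `M` with negative part `K` satisfies `K* M K = -K³ ≤ 0`. -/
lemma exists_compression_nonpos (M : B) (hM : IsSelfAdjoint M) :
    ∃ K Q : B, star K * M * K = -(star Q * Q) ∧ (Q = 0 → 0 ≤ M) := by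
  obtain ⟨S, hS⟩ := CStarAlgebra.nonneg_iff_eq_star_mul_self.mp (CFC.negPart_nonneg M)
  have hneg : star (M⁻) = M⁻ := (IsSelfAdjoint.of_nonneg (CFC.negPart_nonneg M)).star_eq
  refine ⟨M⁻, S * M⁻, ?_, fun hQ ↦ ?_⟩
  · have h : M⁻ * M = - (M⁻ * M⁻) := by
      nth_rewrite 2 [← CFC.posPart_sub_negPart M hM]
      rw [mul_sub, CFC.negPart_mul_posPart, zero_sub]
    rw [star_mul, hneg, h, mul_assoc, ← mul_assoc (star S), ← hS, neg_mul, mul_assoc]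
  · have h6 : M⁻ = 0 := by
      rw [← CStarRing.star_mul_self_eq_zero_iff, hneg]
      nth_rewrite 1 [hS]
      rw [mul_assoc, hQ, mul_zero]
    rw [← CFC.posPart_sub_negPart M hM, h6, sub_zero]
    exact CFC.posPart_nonneg M

variable [Fintype n]

lemma cstarMatrix_nonneg_of_diag (M : CStarMatrix n n B) (hM : IsSelfAdjoint M)
    (h : ∀ (K : CStarMatrix n n B) (p : n), 0 ≤ (star K * M * K) p p) : 0 ≤ M := by
  obtain ⟨K, Q, hKQ, hQ⟩ := exists_compression_nonpos M hM
  refine hQ ?_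
  ext k p
  have h3 := h K p
  have h4 : (star Q * Q) p p = ∑ k, star (Q k p) * Q k p := by
    rw [CStarMatrix.mul_apply]; rfl
  rw [hKQ, CStarMatrix.neg_apply, h4, Left.nonneg_neg_iff] at h3
  have h5 := (Finset.single_le_sum (f := fun k ↦ star (Q k p) * Q k p)
    (fun k _ ↦ star_mul_self_nonneg _) (Finset.mem_univ k)).trans h3
  exact (CStarRing.star_mul_self_eq_zero_iff _).mp (le_antisymm h5 (star_mul_self_nonneg _))

variable [NormedAddCommGroup E] [NormedSpace ℂ E] [SMul Bᵐᵒᵖ E] [CStarModule Bᵐᵒᵖ E]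

variable (B) in
/-- The Gram matrix of a finite family in a right Hilbert `B`-module. -/
def gram (x : n → E) : CStarMatrix n n B :=
  CStarMatrix.ofMatrix fun i j ↦ (inner Bᵐᵒᵖ (x i) (x j)).unop

lemma gram_nonneg (x : n → E) : 0 ≤ gram B x := by
  refine cstarMatrix_nonneg_of_diag _ ?_ fun K p ↦ ?_
  · ext i j
    change star (inner Bᵐᵒᵖ (x j) (x i)).unop = (inner Bᵐᵒᵖ (x i) (x j)).unop
    rw [← MulOpposite.unop_star, CStarModule.star_inner]
  · have : (star K * gram B x * K) p p = (inner Bᵐᵒᵖ (∑ i, MulOpposite.op (K i p) • x i)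
        (∑ i, MulOpposite.op (K i p) • x i)).unop := by
      simp [CStarMatrix.mul_apply, gram, Finset.sum_mul, Finset.mul_sum, mul_assoc,
        CStarMatrix.star_apply]
      rfl
    rw [this]
    exact MulOpposite.unop_le_unop.mpr CStarModule.inner_self_nonneg

end Gram

/-! ## The interior tensor product -/

section InteriorTensor

open scoped TensorProduct
open UniformSpace

variable {B : Type u} {C : Type v} [NonUnitalCStarAlgebra B] [PartialOrder B] [StarOrderedRing B]
  [NonUnitalCStarAlgebra C] [PartialOrder C] [StarOrderedRing C]

/-- The algebraic tensor product (over `ℂ`) underlying `E ⊙ 𝓕`. -/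
def PreTensor (E : Type w') [NormedAddCommGroup E] [NormedSpace ℂ E]
    (𝓕 : Correspondence.{u, v, w} B C) : Type (max w w') := E ⊗[ℂ] 𝓕.carrier

variable (E : Type w') [NormedAddCommGroup E] [NormedSpace ℂ E] [SMul Bᵐᵒᵖ E] [CStarModule Bᵐᵒᵖ E]
  (𝓕 : Correspondence.{u, v, w} B C)

namespace PreTensor

instance : AddCommGroup (PreTensor E 𝓕) := inferInstanceAs (AddCommGroup (E ⊗[ℂ] 𝓕.carrier))

instance : Module ℂ (PreTensor E 𝓕) := inferInstanceAs (Module ℂ (E ⊗[ℂ] 𝓕.carrier))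

/-- The module action `(x ⊗ y) c = x ⊗ (y c)`. -/
instance : SMul Cᵐᵒᵖ (PreTensor E 𝓕) where
  smul c z := LinearMap.lTensor E (smulLin 𝓕.carrier c) z

/-- The sesquilinear form with `⟪x ⊗ y, x' ⊗ y'⟫ = ⟪y, ⟪x, x'⟫ y'⟫`. -/
def form : PreTensor E 𝓕 →ₗ⋆[ℂ] PreTensor E 𝓕 →ₗ[ℂ] Cᵐᵒᵖ :=
  TensorProduct.lift <| LinearMap.mk₂'ₛₗ (starRingEnd ℂ) (starRingEnd ℂ)
    (fun x y ↦ TensorProduct.lift <| LinearMap.mk₂ ℂ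
      (fun x' y' ↦ inner Cᵐᵒᵖ y ((𝓕.leftAction (inner Bᵐᵒᵖ x x').unop).1 y'))
      (by intros; simp) (by intros; simp) (by intros; simp) (by intros; simp))
    (fun x₁ x₂ y ↦ TensorProduct.ext' fun x' y' ↦ by simp; rfl)
    (fun c x y ↦ TensorProduct.ext' fun x' y' ↦ by simp; rfl)
    (fun x y₁ y₂ ↦ TensorProduct.ext' fun x' y' ↦ by simp; rfl)
    (fun c x y ↦ TensorProduct.ext' fun x' y' ↦ by simp; rfl)

instance : Inner Cᵐᵒᵖ (PreTensor E 𝓕) where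
  inner z w := form E 𝓕 z w

variable {E 𝓕}

/-- The elementary tensor `x ⊗ y`. -/
def tmul (x : E) (y : 𝓕.carrier) : PreTensor E 𝓕 := x ⊗ₜ[ℂ] y

lemma form_tmul (x x' : E) (y y' : 𝓕.carrier) : form E 𝓕 (tmul x y) (tmul x' y') =
    inner Cᵐᵒᵖ y ((𝓕.leftAction (inner Bᵐᵒᵖ x x').unop).1 y') := rfl

lemma smul_tmul (c : Cᵐᵒᵖ) (x : E) (y : 𝓕.carrier) : c • tmul (𝓕 := 𝓕) x y = tmul x (c • y) := rfl

lemma induction_on {p : PreTensor E 𝓕 → Prop} (z : PreTensor E 𝓕) (zero : p 0)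
    (tmul : ∀ x y, p (tmul x y)) (add : ∀ z w, p z → p w → p (z + w)) : p z :=
  TensorProduct.induction_on z zero tmul add

lemma form_smul (c : Cᵐᵒᵖ) (z w : PreTensor E 𝓕) : form E 𝓕 z (c • w) = c * form E 𝓕 z w := by
  have hadd : ∀ w₁ w₂ : PreTensor E 𝓕, c • (w₁ + w₂) = c • w₁ + c • w₂ :=
    fun w₁ w₂ ↦ map_add (LinearMap.lTensor E (smulLin 𝓕.carrier c)) w₁ w₂
  have hzero : c • (0 : PreTensor E 𝓕) = 0 := map_zero (LinearMap.lTensor E (smulLin 𝓕.carrier c))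
  induction w using induction_on with
  | zero => simp [hzero]
  | add w₁ w₂ h₁ h₂ => rw [hadd, map_add, map_add, h₁, h₂, mul_add]
  | tmul x' y' =>
    induction z using induction_on with
    | zero => simp
    | add z₁ z₂ h₁ h₂ => rw [map_add, LinearMap.add_apply, LinearMap.add_apply, h₁, h₂, mul_add]
    | tmul x y =>
      rw [smul_tmul, form_tmul, form_tmul, ← Adjointable.inner_adj_left,
        CStarModule.inner_op_smul_right, Adjointable.inner_adj_left]

lemma star_form (z w : PreTensor E 𝓕) : star (form E 𝓕 z w) = form E 𝓕 w z := by
  induction w using induction_on with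
  | zero => simp
  | add w₁ w₂ h₁ h₂ => rw [map_add, map_add, LinearMap.add_apply, star_add, h₁, h₂]
  | tmul x' y' =>
    induction z using induction_on with
    | zero => simp
    | add z₁ z₂ h₁ h₂ => rw [map_add, map_add, LinearMap.add_apply, star_add, h₁, h₂]
    | tmul x y =>
      rw [form_tmul, form_tmul, CStarModule.star_inner, ← Adjointable.inner_adj_right,
        ← Adjointable.star_def, ← map_star, ← MulOpposite.unop_star, CStarModule.star_inner]

lemma form_self_nonneg (z : PreTensor E 𝓕) : 0 ≤ form E 𝓕 z z := by
  obtain ⟨k, x, y, hz⟩ : ∃ (k : ℕ) (x : Fin k → E) (y : Fin k → 𝓕.carrier),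
      z = ∑ i, tmul (x i) (y i) := by
    obtain ⟨k, x, y, hz⟩ := TensorProduct.exists_sum_tmul_eq z
    exact ⟨k, x, y, hz⟩
  have hG : 0 ≤ (gram B x).map 𝓕.leftAction :=
    CompletelyPositiveMapClass.map_cstarMatrix_nonneg' 𝓕.leftAction k _ (gram_nonneg x)
  obtain ⟨N, hN⟩ := exists_eq_star_mul_self hG
  have h1 : ∀ i j, 𝓕.leftAction (inner Bᵐᵒᵖ (x i) (x j)).unop = ∑ l, star (N l i) * N l j := by
    intro i j
    have := congrFun (congrFun hN i) j
    exact this.trans (by rw [CStarMatrix.mul_apply]; rfl)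
  have h2 : form E 𝓕 z z = ∑ l, inner Cᵐᵒᵖ (∑ i, (N l i).1 (y i)) (∑ i, (N l i).1 (y i)) := by
    have h3 : ∀ i j, form E 𝓕 (tmul (x i) (y i)) (tmul (x j) (y j)) =
        ∑ l, inner Cᵐᵒᵖ ((N l i).1 (y i)) ((N l j).1 (y j)) := fun i j ↦ by
      rw [form_tmul, h1, AddSubmonoidClass.coe_finsetSum, sum_apply, CStarModule.inner_sum_right]
      exact Finset.sum_congr rfl fun l _ ↦ Adjointable.inner_adj_right _ _ _
    simp only [hz, map_sum, LinearMap.sum_apply, h3, CStarModule.inner_sum_right,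
      CStarModule.inner_sum_left]
    rw [Finset.sum_comm]
    refine (Finset.sum_congr rfl fun i _ ↦ Finset.sum_comm).trans ?_
    rw [Finset.sum_comm]
    exact Finset.sum_congr rfl fun l _ ↦ Finset.sum_comm
  rw [h2]
  exact Finset.sum_nonneg fun l _ ↦ CStarModule.inner_self_nonneg

instance : Norm (PreTensor E 𝓕) where
  norm z := √‖inner Cᵐᵒᵖ z z‖

instance : SemiCStarModule Cᵐᵒᵖ (PreTensor E 𝓕) where
  inner_add_right' := map_add _ _ _
  inner_self_nonneg' := form_self_nonneg _
  inner_smul_right' := form_smul _ _ _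
  inner_smul_right_complex' := map_smul _ _ _
  star_inner' := star_form
  norm_eq' _ := rfl

instance : SeminormedAddCommGroup (PreTensor E 𝓕) :=
  SeminormedAddCommGroup.ofCore (SemiCStarModule.core Cᵐᵒᵖ (PreTensor E 𝓕))

instance : NormedSpace ℂ (PreTensor E 𝓕) where
  norm_smul_le c z := ((SemiCStarModule.core Cᵐᵒᵖ (PreTensor E 𝓕)).norm_smul c z).le

instance : UniformContinuousConstSMul Cᵐᵒᵖ (PreTensor E 𝓕) :=
  SemiCStarModule.uniformContinuousConstSMul _ _

end PreTensor

/-- The interior tensor product `E ⊙ 𝓕` of a Hilbert `B`-module `E` and a `B`-`C` correspondence `𝓕`: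
the Hilbert `C`-module obtained by Hausdorff completion of the algebraic tensor product with respect
to the semi-inner product `⟪x ⊗ y, x' ⊗ y'⟫ = ⟪y, ⟪x, x'⟫ y'⟫`. (The differences `x b ⊗ y - x ⊗ b y`
have length zero, so that the product is automatically balanced over `B`.) -/
abbrev InteriorTensor : Type (max w w') := Completion (PreTensor E 𝓕)

variable {E 𝓕}

/-- The elementary tensor `x ⊙ y`. -/
def tmul (x : E) (y : 𝓕.carrier) : InteriorTensor E 𝓕 := (PreTensor.tmul x y : PreTensor E 𝓕)

lemma inner_tmul (x x' : E) (y y' : 𝓕.carrier) :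
    inner Cᵐᵒᵖ (tmul (𝓕 := 𝓕) x y) (tmul x' y') =
      inner Cᵐᵒᵖ y ((𝓕.leftAction (inner Bᵐᵒᵖ x x').unop).1 y') :=
  SemiCStarModule.inner_coe _ _

lemma dense_span_tmul :
    (Submodule.span ℂ {z : InteriorTensor E 𝓕 | ∃ x y, z = tmul x y}).topologicalClosure = ⊤ := by
  rw [← Submodule.dense_iff_topologicalClosure_eq_top]
  refine Completion.denseRange_coe.mono ?_
  rintro _ ⟨z, rfl⟩
  induction z using PreTensor.induction_on with
  | zero => exact Submodule.zero_mem _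
  | add z₁ z₂ h₁ h₂ => rw [Completion.coe_add]; exact Submodule.add_mem _ h₁ h₂
  | tmul x y => exact Submodule.subset_span ⟨x, y, rfl⟩

namespace PreTensor

variable (𝓕) in
/-- `a ⊗ id` on the algebraic tensor product. -/
def amp (a : E →L[ℂ] E) : PreTensor E 𝓕 →ₗ[ℂ] PreTensor E 𝓕 :=
  LinearMap.rTensor 𝓕.carrier a.toLinearMap

lemma amp_tmul (a : E →L[ℂ] E) (x : E) (y : 𝓕.carrier) : amp 𝓕 a (tmul x y) = tmul (a x) y := rfl

lemma form_amp (a : Adjointable Bᵐᵒᵖ E E) (z w : PreTensor E 𝓕) :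
    form E 𝓕 (amp 𝓕 a.1 z) w = form E 𝓕 z (amp 𝓕 (Adjointable.adj a).1 w) := by
  induction w using induction_on with
  | zero => simp
  | add w₁ w₂ h₁ h₂ => rw [map_add, map_add, map_add, h₁, h₂]
  | tmul x' y' =>
    induction z using induction_on with
    | zero => simp
    | add z₁ z₂ h₁ h₂ => rw [map_add, map_add, map_add, LinearMap.add_apply, LinearMap.add_apply, h₁, h₂]
    | tmul x y => rw [amp_tmul, amp_tmul, form_tmul, form_tmul, Adjointable.inner_adj_right]

lemma norm_amp_le [CompleteSpace E] (a : Adjointable Bᵐᵒᵖ E E) (z : PreTensor E 𝓕) :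
    ‖amp 𝓕 a.1 z‖ ≤ ‖a‖ * ‖z‖ := by
  obtain ⟨c, hc⟩ := CStarAlgebra.nonneg_iff_eq_star_mul_self.mp
    (sub_nonneg.mpr (CStarAlgebra.star_mul_le_algebraMap_norm_sq (a := a)))
  have h1 : form E 𝓕 (amp 𝓕 a.1 z) (amp 𝓕 a.1 z) + form E 𝓕 (amp 𝓕 c.1 z) (amp 𝓕 c.1 z) =
      (‖a‖ ^ 2) • form E 𝓕 z z := by
    have hac : (Adjointable.adj a).1 * a.1 + (Adjointable.adj c).1 * c.1 =
        ((‖a‖ ^ 2 : ℝ) : ℂ) • (1 : E →L[ℂ] E) := by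
      have : star a * a + star c * c = ((‖a‖ ^ 2 : ℝ) : ℂ) • (1 : Adjointable Bᵐᵒᵖ E E) := by
        rw [← hc, add_sub_cancel, Algebra.algebraMap_eq_smul_one]; rfl
      exact congrArg Subtype.val this
    have hz : amp 𝓕 (Adjointable.adj a).1 (amp 𝓕 a.1 z) + amp 𝓕 (Adjointable.adj c).1 (amp 𝓕 c.1 z)
        = ((‖a‖ ^ 2 : ℝ) : ℂ) • z := by
      induction z using induction_on with
      | zero => simp
      | add z₁ z₂ h₁ h₂ => rw [smul_add, ← h₁, ← h₂]; simp only [map_add]; abel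
      | tmul x y =>
        have h := congrArg (fun f : E →L[ℂ] E ↦ tmul (𝓕 := 𝓕) (f x) y) hac
        simp only [amp_tmul]
        refine (TensorProduct.add_tmul _ _ _).symm.trans (h.trans ?_)
        exact (TensorProduct.smul_tmul' _ _ _).symm
    rw [form_amp, form_amp, ← map_add, hz, map_smul]
    rfl
  have h2 : form E 𝓕 (amp 𝓕 a.1 z) (amp 𝓕 a.1 z) ≤ (‖a‖ ^ 2) • form E 𝓕 z z := by
    rw [← h1]; exact le_add_of_nonneg_right (form_self_nonneg _)
  have h3 := CStarAlgebra.norm_le_norm_of_nonneg_of_le (form_self_nonneg _) h2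
  refine (pow_le_pow_iff_left₀ (norm_nonneg _) (by positivity) two_ne_zero).mp ?_
  rw [mul_pow, SemiCStarModule.norm_sq' (A := Cᵐᵒᵖ), SemiCStarModule.norm_sq' (A := Cᵐᵒᵖ) z]
  refine h3.trans_eq ((norm_smul (‖a‖ ^ 2) (form E 𝓕 z z)).trans ?_)
  rw [Real.norm_of_nonneg (by positivity)]
  rfl

variable (𝓕) in
/-- `a ⊗ id` on the algebraic tensor product, as a bounded operator. -/
def ampCLM [CompleteSpace E] (a : Adjointable Bᵐᵒᵖ E E) : PreTensor E 𝓕 →L[ℂ] PreTensor E 𝓕 :=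
  (amp 𝓕 a.1).mkContinuous ‖a‖ (norm_amp_le a)

end PreTensor

lemma inner_ampCLM_completion [CompleteSpace E] (a : Adjointable Bᵐᵒᵖ E E)
    (z w : InteriorTensor E 𝓕) : inner Cᵐᵒᵖ ((PreTensor.ampCLM 𝓕 a).completion z) w =
      inner Cᵐᵒᵖ z ((PreTensor.ampCLM 𝓕 (Adjointable.adj a)).completion w) := by
  induction z, w using Completion.induction_on₂ with
  | hp =>
    exact isClosed_eq
      (CStarModule.continuous_inner.comp (by fun_prop : Continuous fun p :
        InteriorTensor E 𝓕 × InteriorTensor E 𝓕 ↦ ((PreTensor.ampCLM 𝓕 a).completion p.1, p.2)))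
      (CStarModule.continuous_inner.comp (by fun_prop : Continuous fun p :
        InteriorTensor E 𝓕 × InteriorTensor E 𝓕 ↦
          (p.1, (PreTensor.ampCLM 𝓕 (Adjointable.adj a)).completion p.2)))
  | ih z w =>
    rw [ContinuousLinearMap.completion_apply_coe, ContinuousLinearMap.completion_apply_coe,
      SemiCStarModule.inner_coe, SemiCStarModule.inner_coe]
    exact PreTensor.form_amp a z w

variable (𝓕) in
/-- `a ⊙ id ∈ 𝓑ᵃ(E ⊙ 𝓕)` for `a ∈ 𝓑ᵃ(E)`: the continuous extension of `x ⊗ y ↦ a x ⊗ y`. -/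
def amplify [CompleteSpace E] (a : Adjointable Bᵐᵒᵖ E E) :
    Adjointable Cᵐᵒᵖ (InteriorTensor E 𝓕) (InteriorTensor E 𝓕) :=
  ⟨(PreTensor.ampCLM 𝓕 a).completion, (PreTensor.ampCLM 𝓕 (Adjointable.adj a)).completion,
    inner_ampCLM_completion a⟩

lemma amplify_tmul [CompleteSpace E] (a : Adjointable Bᵐᵒᵖ E E) (x : E) (y : 𝓕.carrier) :
    (amplify 𝓕 a).1 (tmul x y) = tmul (a.1 x) y :=
  ContinuousLinearMap.completion_apply_coe _ _

end InteriorTensor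

end HilbertCStar

end

open HilbertCStar
open scoped CStarAlgebra

/-! In a Stinespring dilation of `T`, the vectors `aΞf` have inner products `⟪aΞf, bΞg⟫ = ⟪f,
T(a*b)g⟫`. Strictness should allow `a` to be replaced by finite-rank operators `∑ xᵢyᵢ*`. The
vectors `(xy*)Ξf` have the form `x ⊙ (ȳ ⊗ f)`, which suggests taking for `𝓕` the completion of `Ē ⊗
F` under `⟪x̄ ⊗ f, x̄' ⊗ f'⟫ = ⟪f, T(xx'*)f'⟫`. This form is positive because the matrices `(xᵢxⱼ*)`
are positive and `T` is completely positive. `B` acts by `b(x̄ ⊗ f) = (xb*)‾ ⊗ f`.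

Put `Ψ(∑ xᵢ ⊗ yᵢ)f = ∑ xᵢ ⊙ (ȳᵢ ⊗ f)` (`rankTensor`). The computation carrying the proof is
`inner_rankTensor`: `⟪Ψ(s)f, (a ⊙ id)Ψ(t)g⟫ = ⟪f, T(s*at)g⟫`. Accordingly `Ξf` is the limit of
`Ψ(u)f` as `u` runs through self-adjoint finite-rank contractions converging strongly to the
identity; these exist by functional calculus (`exists_finiteRank_approx`). Then `⟪Ξf, (a ⊙ id)Ψ(s)g⟫
= ⟪f, T(as)g⟫`. With `a = 1` this gives the adjoint of `Ξ` on a total set, and letting `s` run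
through the same net gives the formula for `T(a)`.

Strictness controls `T` only on compact operators of `F`, that is, on vectors `x⟪y, z⟫`. Two devices
replace a factorization of arbitrary vectors in this form. For the existence of the limit, `q = ⟪f,
T(w*w)f⟫` is dominated by a multiple of `p = ⟪f, f⟫`, so that `pq → 0` forces `q → 0`
(`sq_norm_le_of_le_smul`). For the final identity, an error vector `d` with `d⟪d, d⟫ = 0` vanishes
(`eq_zero_of_inner_smul_self_eq_zero`). -/

noncomputable section

namespace HilbertCStar

open Filter Topology UniformSpace
open scoped TensorProduct

/-! ### Hilbert module preliminaries -/

section Basics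

variable {A E F : Type*} [NonUnitalCStarAlgebra A] [PartialOrder A]
  [NormedAddCommGroup E] [NormedSpace ℂ E] [SMul A E] [CStarModule A E]
  [NormedAddCommGroup F] [NormedSpace ℂ F] [SMul A F] [CStarModule A F]

lemma mul_smul_mod (a b : A) (x : E) : (a * b) • x = a • b • x :=
  ext_inner_left (A := A) fun z ↦ by simp [mul_assoc]

lemma Adjointable.map_smul_mod (f : Adjointable A E F) (a : A) (x : E) :
    f.1 (a • x) = a • f.1 x :=
  ext_inner_left (A := A) fun z ↦ by
    rw [← Adjointable.inner_adj_left, CStarModule.inner_op_smul_right,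
      CStarModule.inner_op_smul_right, Adjointable.inner_adj_left]

/-- Pairing the hypothesis with `w` shows that the self-adjoint element `⟪w, w⟫` has square zero.
This lets an identity known only on vectors `x⟪y, z⟫` be extended to all vectors. -/
lemma eq_zero_of_inner_smul_self_eq_zero {w : E} (h : inner A w w • w = 0) : w = 0 := by
  have h1 : inner A w w * inner A w w = 0 := by
    rw [← CStarModule.inner_op_smul_right, h, CStarModule.inner_zero_right]
  rw [← CStarModule.inner_self (A := A), ← CStarRing.star_mul_self_eq_zero_iff,
    CStarModule.star_inner, h1]

variable [StarOrderedRing A]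

lemma Adjointable.inner_apply_nonneg [CompleteSpace E] {f : Adjointable A E E} (hf : 0 ≤ f)
    (x : E) : 0 ≤ inner A x (f.1 x) := by
  obtain ⟨c, rfl⟩ := CStarAlgebra.nonneg_iff_eq_star_mul_self.mp hf
  rw [Adjointable.coe_mul, Adjointable.star_def, mul_apply_eq_comp,
    Adjointable.inner_adj_right]
  exact CStarModule.inner_self_nonneg

/-- Testing on vectors `Kx`, with `K` the negative part of `f`, produces `-⟪Qx, Qx⟫`, which can be
nonnegative only if `Qx = 0`. -/
lemma Adjointable.nonneg_of_inner [CompleteSpace E] {f : Adjointable A E E}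
    (hf : IsSelfAdjoint f) (h : ∀ x, 0 ≤ inner A x (f.1 x)) : 0 ≤ f := by
  obtain ⟨K, Q, hKQ, hQ⟩ := exists_compression_nonpos f hf
  refine hQ (Adjointable.ext' fun x ↦ ?_)
  have h1 := h (K.1 x)
  have h2 : inner A (K.1 x) (f.1 (K.1 x)) = -inner A (Q.1 x) (Q.1 x) := by
    rw [← Adjointable.inner_adj_right, ← Adjointable.inner_adj_right, ← CStarModule.inner_neg_right]
    exact congrArg (fun g : Adjointable A E E ↦ inner A x (g.1 x)) hKQ
  rw [h2, Left.nonneg_neg_iff] at h1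
  exact CStarModule.inner_self.mp (le_antisymm h1 CStarModule.inner_self_nonneg)

lemma Adjointable.inner_apply_mono [CompleteSpace E] {f g : Adjointable A E E} (hfg : f ≤ g)
    (x : E) : inner A x (f.1 x) ≤ inner A x (g.1 x) := by
  have h := Adjointable.inner_apply_nonneg (sub_nonneg.mpr hfg) x
  rwa [AddSubgroupClass.coe_sub, _root_.sub_apply, CStarModule.inner_sub_right,
    sub_nonneg] at h

lemma tendsto_inner {ι : Type*} {l : Filter ι} {f g : ι → E} {x y : E}
    (hf : Tendsto f l (𝓝 x)) (hg : Tendsto g l (𝓝 y)) :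
    Tendsto (fun i ↦ inner A (f i) (g i)) l (𝓝 (inner A x y)) :=
  (CStarModule.continuous_inner (A := A) (E := E)).continuousAt.tendsto.comp (hf.prodMk_nhds hg)

/-- A bounded operator between Hilbert modules is adjointable as soon as its adjoint is defined on
a total set. -/
lemma mem_adjointable_of_dense [CompleteSpace E] (L : E →L[ℂ] F) (D : Set F)
    (hD : (Submodule.span ℂ D).topologicalClosure = ⊤)
    (h : ∀ z ∈ D, ∃ s : E, ∀ x, inner A (L x) z = inner A x s) : L ∈ Adjointable A E F := by
  -- This a priori bound serves twice: it makes the domain `P` of the adjoint closed, and it bounds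
  -- the adjoint once `P` is everything.
  have hbound : ∀ {z : F} {s : E}, (∀ x, inner A (L x) z = inner A x s) → ‖s‖ ≤ ‖L‖ * ‖z‖ := by
    intro z s hs
    rcases (norm_nonneg s).eq_or_lt with h0 | h0
    · rw [← h0]; positivity
    · refine le_of_mul_le_mul_right ?_ h0
      calc ‖s‖ * ‖s‖ = ‖inner A s s‖ := by rw [← CStarModule.norm_sq_eq A, sq]
        _ = ‖inner A (L s) z‖ := by rw [hs]
        _ ≤ ‖L s‖ * ‖z‖ := CStarModule.norm_inner_le F
        _ ≤ ‖L‖ * ‖s‖ * ‖z‖ := by gcongr; exact L.le_opNorm s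
        _ = _ := by ring
  let P : Submodule ℂ F :=
    { carrier := {z | ∃ s : E, ∀ x, inner A (L x) z = inner A x s}
      add_mem' := by
        rintro z z' ⟨s, hs⟩ ⟨s', hs'⟩
        exact ⟨s + s', fun x ↦ by simp [hs, hs']⟩
      zero_mem' := ⟨0, fun x ↦ by simp⟩
      smul_mem' := by
        rintro c z ⟨s, hs⟩
        exact ⟨c • s, fun x ↦ by simp [hs]⟩ }
  have hP : IsClosed (P : Set F) := by
    rw [← isSeqClosed_iff_isClosed]
    intro u z hu hz
    choose s hs using hu
    have hc : CauchySeq s := by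
      refine Metric.cauchySeq_iff.mpr fun ε hε ↦ ?_
      obtain ⟨N, hN⟩ := Metric.cauchySeq_iff.mp hz.cauchySeq (ε / (‖L‖ + 1)) (by positivity)
      refine ⟨N, fun m hm n hn ↦ ?_⟩
      rw [dist_eq_norm]
      have h1 : ‖s m - s n‖ ≤ ‖L‖ * ‖u m - u n‖ := hbound fun x ↦ by simp [hs]
      have h2 := hN m hm n hn
      rw [dist_eq_norm, lt_div_iff₀ (by positivity)] at h2
      nlinarith [norm_nonneg (u m - u n)]
    obtain ⟨t, ht⟩ := cauchySeq_tendsto_of_complete hc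
    refine ⟨t, fun x ↦ tendsto_nhds_unique (tendsto_inner tendsto_const_nhds hz) ?_⟩
    simp only [hs]
    exact tendsto_inner tendsto_const_nhds ht
  have htop : ∀ z, z ∈ P := fun z ↦ by
    have : (Submodule.span ℂ D).topologicalClosure ≤ P :=
      Submodule.topologicalClosure_minimal _ (Submodule.span_le.mpr h) hP
    exact this (hD ▸ Submodule.mem_top)
  choose s hs using htop
  refine ⟨LinearMap.mkContinuous
    { toFun := s
      map_add' := fun z w ↦ ext_inner_left (A := A) fun x ↦ by
        rw [← hs, CStarModule.inner_add_right, CStarModule.inner_add_right, hs, hs]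
      map_smul' := fun c z ↦ ext_inner_left (A := A) fun x ↦ by
        rw [← hs, CStarModule.inner_smul_right_complex, RingHom.id_apply,
          CStarModule.inner_smul_right_complex, hs] } ‖L‖ fun z ↦ hbound (hs z), fun x z ↦ hs z x⟩

/-- If `e` runs through an approximate unit, then `e x → x`. -/
lemma tendsto_approximateUnit_smul (x : E) :
    Tendsto (fun e : A ↦ e • x) (CStarAlgebra.approximateUnit A) (𝓝 x) := by
  have hl := CStarAlgebra.increasingApproximateUnit A
  set p := inner A x x with hp
  have h1 : Tendsto (fun e : A ↦ 2 * ‖p - e * p‖) (CStarAlgebra.approximateUnit A) (𝓝 0) := by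
    have := (tendsto_const_nhds (x := p)).sub (hl.tendsto_mul_right p)
    simpa using this.norm.const_mul 2
  have h2 : Tendsto (fun e : A ↦ ‖e • x - x‖ ^ 2) (CStarAlgebra.approximateUnit A) (𝓝 0) := by
    refine squeeze_zero' (Eventually.of_forall fun e ↦ by positivity) ?_ h1
    filter_upwards [hl.eventually_norm] with e he
    -- The expansion reduces the claim to `ep → p` in the algebra, where `p = ⟪x, x⟫`.
    have h3 : inner A (e • x - x) (e • x - x) = (p - e * p) - (p - e * p) * star e := by
      simp only [CStarModule.inner_sub_left, CStarModule.inner_sub_right,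
        CStarModule.inner_op_smul_left, CStarModule.inner_op_smul_right, ← hp, sub_mul, mul_sub,
        mul_assoc]
      abel
    rw [CStarModule.norm_sq_eq A, h3]
    calc _ ≤ ‖p - e * p‖ + ‖p - e * p‖ * ‖star e‖ :=
          (norm_sub_le _ _).trans (by gcongr; exact norm_mul_le _ _)
      _ ≤ ‖p - e * p‖ + ‖p - e * p‖ * 1 := by rw [norm_star]; gcongr
      _ = _ := by ring
  rw [tendsto_iff_norm_sub_tendsto_zero]
  simpa using h2.sqrt

end Basics

/-! ### Rank-one operators and strict convergence -/

section RankOne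

variable {A E : Type*} [NonUnitalCStarAlgebra A] [PartialOrder A] [StarOrderedRing A]
  [NormedAddCommGroup E] [NormedSpace ℂ E] [SMul A E] [CStarModule A E]

lemma mul_rankOne (f : Adjointable A E E) (x y : E) :
    f * rankOne A x y = rankOne A (f.1 x) y :=
  Adjointable.ext' fun _ ↦ Adjointable.map_smul_mod f _ _

lemma star_rankOne (x y : E) : star (rankOne A x y) = rankOne A y x :=
  (Adjointable.eq_adj fun z w ↦ by simp [rankOne_apply]).symm

lemma rankOne_mul (f : Adjointable A E E) (x y : E) :
    rankOne A x y * f = rankOne A x ((Adjointable.adj f).1 y) := by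
  rw [← star_rankOne y x, ← star_rankOne _ x, ← Adjointable.star_def, ← mul_rankOne, star_mul,
    star_star]

lemma rankOne_smul_smul (a : A) (x y : E) : rankOne A (a • x) y = rankOne A x (star a • y) :=
  Adjointable.ext' fun z ↦ by simp [rankOne_apply, mul_smul_mod]

lemma rankOne_mul_rankOne (x x' y y' : E) :
    rankOne A x y * rankOne A x' y' = rankOne A (inner A y x' • x) y' := by
  rw [mul_rankOne, rankOne_apply]

lemma rankOne_add_left (x x' y : E) : rankOne A (x + x') y = rankOne A x y + rankOne A x' y :=
  Adjointable.ext' fun z ↦ ext_inner_left (A := A) fun w ↦ by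
    simp [rankOne_apply, mul_add]

lemma rankOne_add_right (x y y' : E) : rankOne A x (y + y') = rankOne A x y + rankOne A x y' := by
  rw [← star_rankOne, rankOne_add_left, star_add, star_rankOne, star_rankOne]

lemma rankOne_smul_left (c : ℂ) (x y : E) : rankOne A (c • x) y = c • rankOne A x y :=
  Adjointable.ext' fun z ↦ ext_inner_left (A := A) fun w ↦ by
    simp [rankOne_apply, mul_smul_comm]

lemma rankOne_smul_right (c : ℂ) (x y : E) : rankOne A x (c • y) = star c • rankOne A x y := by
  rw [← star_rankOne, rankOne_smul_left, star_smul, star_rankOne]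

variable (A) in
lemma norm_rankOne_le (x y : E) : ‖rankOne A x y‖ ≤ ‖x‖ * ‖y‖ :=
  ContinuousLinearMap.opNorm_le_bound _ (by positivity) fun z ↦
    calc ‖inner A y z • x‖ ≤ ‖inner A y z‖ * ‖x‖ := norm_smul_mod_le _ _
      _ ≤ ‖y‖ * ‖z‖ * ‖x‖ := by gcongr; exact CStarModule.norm_inner_le E
      _ = _ := by ring

variable (A) in
-- Evaluating `xx*` between `x` and `x` gives `⟪x, x⟫²`, of norm `‖x‖⁴`. It converts operator
-- inequalities for `xx*` into estimates for the vector `x`.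
lemma sq_norm_le_norm_rankOne (x : E) : ‖x‖ ^ 2 ≤ ‖rankOne A x x‖ := by
  rcases (norm_nonneg x).eq_or_lt with h0 | h0
  · rw [← h0]; simp
  have hp : ‖inner A x x * inner A x x‖ = ‖x‖ ^ 4 := by
    have := CStarRing.norm_star_mul_self (x := inner A x x)
    rw [CStarModule.star_inner] at this
    rw [this, ← CStarModule.norm_sq_eq A]; ring
  have h1 : ‖x‖ ^ 4 ≤ ‖rankOne A x x‖ * ‖x‖ ^ 2 :=
    calc ‖x‖ ^ 4 = ‖inner A x ((rankOne A x x).1 x)‖ := by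
          rw [rankOne_apply, CStarModule.inner_op_smul_right, hp]
      _ ≤ ‖x‖ * ‖(rankOne A x x).1 x‖ := CStarModule.norm_inner_le E
      _ ≤ ‖x‖ * (‖rankOne A x x‖ * ‖x‖) := by
          gcongr; exact (rankOne A x x).1.le_opNorm x
      _ = _ := by ring
  refine le_of_mul_le_mul_right ?_ (pow_pos h0 2)
  linarith [pow_add ‖x‖ 2 2]

lemma rankOne_self_nonneg [CompleteSpace E] (x : E) : 0 ≤ rankOne A x x := by
  refine Adjointable.nonneg_of_inner (star_rankOne x x) fun z ↦ ?_
  rw [rankOne_apply, CStarModule.inner_op_smul_right, ← CStarModule.star_inner z x]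
  exact star_mul_self_nonneg _

/-- The operator matrix `(xᵢ xⱼ*)` is positive. -/
lemma rankOne_matrix_nonneg [CompleteSpace E] {n : Type*} [Fintype n] (x : n → E) :
    0 ≤ (CStarMatrix.ofMatrix fun i j ↦ rankOne A (x i) (x j) :
      CStarMatrix n n (Adjointable A E E)) := by
  refine cstarMatrix_nonneg_of_diag _ ?_ fun K p ↦ ?_
  · exact CStarMatrix.ext fun i j ↦ star_rankOne (A := A) (x j) (x i)
  · let R : E →ₗ⋆[ℂ] E →ₗ[ℂ] Adjointable A E E := LinearMap.mk₂'ₛₗ (starRingEnd ℂ) (RingHom.id ℂ)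
      (fun y x ↦ rankOne A x y) (fun _ _ _ ↦ rankOne_add_right _ _ _)
      (fun _ _ _ ↦ rankOne_smul_right _ _ _) (fun _ _ _ ↦ rankOne_add_left _ _ _)
      (fun _ _ _ ↦ rankOne_smul_left _ _ _)
    have h : ∀ y x, R y x = rankOne A x y := fun _ _ ↦ rfl
    -- The diagonal entry is `rr*` with `r = ∑ (K i p)* xᵢ`.
    have : (star K * CStarMatrix.ofMatrix (fun i j ↦ rankOne A (x i) (x j)) * K) p p =
        R (∑ i, (star (K i p)).1 (x i)) (∑ i, (star (K i p)).1 (x i)) := by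
      simp only [map_sum, LinearMap.sum_apply, h, ← mul_rankOne]
      simp only [CStarMatrix.mul_apply, Finset.sum_mul, CStarMatrix.star_apply]
      rw [Finset.sum_comm]
      refine Finset.sum_congr rfl fun j _ ↦ Finset.sum_congr rfl fun i _ ↦ ?_
      change star (K j p) * rankOne A (x j) (x i) * K i p = _
      rw [mul_assoc, rankOne_mul]
      rfl
    rw [this]
    exact rankOne_self_nonneg _

/-- A bounded net that converges strongly together with its adjoints converges strictly. -/
lemma strictTendsto_of_strong {ι : Type*} {l : Filter ι} {f : ι → Adjointable A E E}
    {a : Adjointable A E E} {r : ℝ} (hr : ∀ᶠ i in l, ‖f i‖ ≤ r)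
    (h : ∀ x, Tendsto (fun i ↦ (f i).1 x) l (𝓝 (a.1 x)))
    (h' : ∀ x, Tendsto (fun i ↦ (star (f i)).1 x) l (𝓝 ((star a).1 x))) :
    StrictTendsto f l a := by
  -- A uniformly bounded family of maps tending to zero on rank-one operators tends to zero on their
  -- closed span. It is applied to left and to right multiplication by `f i - a`.
  have hclosed : ∀ (φ : ι → Adjointable A E E →L[ℂ] Adjointable A E E)
      (_ : ∀ᶠ i in l, ‖φ i‖ ≤ r + ‖a‖)
      (_ : ∀ x y, Tendsto (fun i ↦ φ i (rankOne A x y)) l (𝓝 0)),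
      ∀ k ∈ compactOps A E, Tendsto (fun i ↦ φ i k) l (𝓝 0) := by
    intro φ hφ h0 k hk
    have hspan : ∀ k ∈ Submodule.span ℂ {k | ∃ x y : E, k = rankOne A x y},
        Tendsto (fun i ↦ φ i k) l (𝓝 0) := by
      intro k hk
      induction hk using Submodule.span_induction with
      | mem k hk => obtain ⟨x, y, rfl⟩ := hk; exact h0 x y
      | zero => simpa using tendsto_const_nhds
      | add k k' _ _ h h' => simpa using h.add h'
      | smul c k _ h => simpa using h.const_smul c
    rw [Metric.tendsto_nhds]
    intro ε hε
    have hM : 0 < |r| + ‖a‖ + 1 := by positivity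
    obtain ⟨k', hk', hd⟩ := Metric.mem_closure_iff.mp hk (ε / (2 * (|r| + ‖a‖ + 1)))
      (by positivity)
    filter_upwards [hφ, Metric.tendsto_nhds.mp (hspan k' hk') (ε / 2) (by positivity)] with i h1 h2
    rw [dist_zero_right] at h2 ⊢
    rw [dist_eq_norm, lt_div_iff₀ (by positivity)] at hd
    calc ‖φ i k‖ = ‖φ i (k - k') + φ i k'‖ := by rw [map_sub, sub_add_cancel]
      _ ≤ ‖φ i‖ * ‖k - k'‖ + ‖φ i k'‖ :=
          (norm_add_le _ _).trans (by gcongr; exact (φ i).le_opNorm _)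
      _ ≤ (|r| + ‖a‖ + 1) * ‖k - k'‖ + ‖φ i k'‖ := by
          gcongr
          linarith [le_abs_self r]
      _ < ε := by linarith
  have hbd : ∀ᶠ i in l, ‖f i - a‖ ≤ r + ‖a‖ := by
    filter_upwards [hr] with i hi
    exact (norm_sub_le _ _).trans (by gcongr)
  intro k hk
  constructor
  · refine tendsto_sub_nhds_zero_iff.mp ?_
    simp only [← sub_mul]
    refine hclosed (fun i ↦ ContinuousLinearMap.mul ℂ _ (f i - a)) ?_ (fun x y ↦ ?_) k hk
    · filter_upwards [hbd] with i hi
      exact (ContinuousLinearMap.opNorm_mul_apply_le _ _ _).trans hi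
    · simp only [ContinuousLinearMap.mul_apply', mul_rankOne]
      refine squeeze_zero_norm (fun i ↦ norm_rankOne_le A _ _) ?_
      have := ((tendsto_sub_nhds_zero_iff.mpr (h x)).norm.mul_const ‖y‖)
      simpa using this
  · refine tendsto_sub_nhds_zero_iff.mp ?_
    simp only [← mul_sub]
    refine hclosed (fun i ↦ (ContinuousLinearMap.mul ℂ (Adjointable A E E)).flip (f i - a)) ?_
      (fun x y ↦ ?_) k hk
    · filter_upwards [hbd] with i hi
      refine (ContinuousLinearMap.opNorm_le_bound _ (norm_nonneg (f i - a)) fun k ↦ ?_).trans hi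
      exact (norm_mul_le _ _).trans_eq (mul_comm _ _)
    · simp only [ContinuousLinearMap.flip_apply, ContinuousLinearMap.mul_apply', rankOne_mul,
        ← Adjointable.star_def]
      refine squeeze_zero_norm (fun i ↦ norm_rankOne_le A _ _) ?_
      have := ((tendsto_sub_nhds_zero_iff.mpr (h' y)).norm.const_mul ‖x‖)
      simpa [star_sub] using this

/-- A strict map sends bounded strictly convergent nets to strictly convergent nets, with the
expected limit. -/
lemma IsStrict.tendsto_mul {A' E' : Type*} [NonUnitalCStarAlgebra A'] [PartialOrder A']
    [StarOrderedRing A'] [NormedAddCommGroup E'] [NormedSpace ℂ E'] [SMul A' E'] [CStarModule A' E']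
    {T : Adjointable A E E → Adjointable A' E' E'} (hT : IsStrict T)
    {ι : Type*} {l : Filter ι} {f : ι → Adjointable A E E} {a : Adjointable A E E} {r : ℝ}
    (hr : ∀ᶠ i in l, ‖f i‖ ≤ r) (h : StrictTendsto f l a) {k : Adjointable A' E' E'}
    (hk : k ∈ compactOps A' E') : Tendsto (fun i ↦ T (f i) * k) l (𝓝 (T a * k)) := by
  -- Adjoining the point `a` itself to the net forces the unspecified limit `b` to agree with `T a`
  -- on compact operators.
  obtain ⟨b, hb⟩ := hT (l.map f ⊔ pure a) (max r ‖a‖) a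
    (eventually_sup.mpr ⟨eventually_map.mpr (hr.mono fun i hi ↦ le_max_of_le_left hi),
      eventually_pure.mpr (le_max_right _ _)⟩)
    fun k hk ↦ ⟨tendsto_sup.mpr ⟨tendsto_map'_iff.mpr (h k hk).1, tendsto_pure_left.mpr
        fun s hs ↦ mem_of_mem_nhds hs⟩,
      tendsto_sup.mpr ⟨tendsto_map'_iff.mpr (h k hk).2, tendsto_pure_left.mpr
        fun s hs ↦ mem_of_mem_nhds hs⟩⟩
  obtain ⟨h1, h2⟩ := tendsto_sup.mp (hb k hk).1
  have h3 : T a * k = b * k :=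
    tendsto_nhds_unique (tendsto_pure_nhds (fun x ↦ T x * k) a) h2
  rw [h3]
  exact tendsto_map'_iff.mp h1

/-- Convergence against the compact operator `xy*`, evaluated at `z`. The restriction to vectors
`x⟪y, z⟫` is what the later arguments have to work around. -/
lemma IsStrict.tendsto_apply {A' E' : Type*} [NonUnitalCStarAlgebra A'] [PartialOrder A']
    [StarOrderedRing A'] [NormedAddCommGroup E'] [NormedSpace ℂ E'] [SMul A' E'] [CStarModule A' E']
    {T : Adjointable A E E → Adjointable A' E' E'} (hT : IsStrict T)
    {ι : Type*} {l : Filter ι} {f : ι → Adjointable A E E} {a : Adjointable A E E} {r : ℝ}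
    (hr : ∀ᶠ i in l, ‖f i‖ ≤ r) (h : StrictTendsto f l a) (x y z : E') :
    Tendsto (fun i ↦ (T (f i)).1 (inner A' y z • x)) l (𝓝 ((T a).1 (inner A' y z • x))) := by
  have hk : rankOne A' x y ∈ compactOps A' E' :=
    Submodule.le_topologicalClosure _ (Submodule.subset_span ⟨x, y, rfl⟩)
  have h1 := hT.tendsto_mul hr h hk
  let ev : Adjointable A' E' E' →L[ℂ] E' :=
    (ContinuousLinearMap.apply ℂ E' z).comp (Adjointable A' E' E').subtypeL
  exact (ev.continuous.tendsto _).comp h1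

end RankOne

/-- The complex conjugate of a complex vector space. -/
def Conj (E : Type*) : Type _ := E

namespace Conj

variable {E : Type*} [AddCommGroup E] [Module ℂ E]

instance : AddCommGroup (Conj E) := inferInstanceAs (AddCommGroup E)

instance : Module ℂ (Conj E) := Module.compHom E (starRingEnd ℂ)

/-- The identity `E → Conj E`. -/
def mk : E →ₗ⋆[ℂ] Conj E where
  toFun x := x
  map_add' _ _ := rfl
  map_smul' c x := by
    change c • x = (starRingEnd ℂ) ((starRingEnd ℂ) c) • x
    rw [Complex.conj_conj]

/-- The identity `Conj E → E`. -/
def out : Conj E →ₗ⋆[ℂ] E where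
  toFun x := x
  map_add' _ _ := rfl
  map_smul' _ _ := rfl

@[simp] lemma out_mk (x : E) : out (mk x) = x := rfl

@[simp] lemma mk_out (x : Conj E) : mk (out x) = x := rfl

end Conj

/-! ### Finite-rank approximate units -/

section FiniteRank

variable (A E : Type*) [NonUnitalCStarAlgebra A] [PartialOrder A] [StarOrderedRing A]
  [NormedAddCommGroup E] [NormedSpace ℂ E] [SMul A E] [CStarModule A E]

/-- The finite-rank operator `∑ xᵢ yᵢ*` given by `∑ xᵢ ⊗ yᵢ`. -/
def finiteRank : E ⊗[ℂ] Conj E →ₗ[ℂ] Adjointable A E E :=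
  TensorProduct.lift <| LinearMap.mk₂ ℂ (fun x y ↦ rankOne A x (Conj.out y))
    (fun _ _ _ ↦ rankOne_add_left _ _ _) (fun _ _ _ ↦ rankOne_smul_left _ _ _)
    (fun _ _ _ ↦ by rw [map_add]; exact rankOne_add_right _ _ _)
    (fun _ _ _ ↦ by rw [LinearMap.map_smulₛₗ, rankOne_smul_right]; simp)

variable {A E}

lemma finiteRank_tmul (x y : E) : finiteRank A E (x ⊗ₜ Conj.mk y) = rankOne A x y := rfl

/-- With `k = ∑ xx*` over `s`, the operator `u = k(k + ε)⁻¹` is a self-adjoint contraction, and it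
has finite rank because `kv = ∑ x(vx)*` for `v = (k + ε)⁻¹`. From `xx* ≤ k` follows `‖(1 - u)x‖² ≤
‖(1 - u)k(1 - u)‖`, and on the spectrum `tε²/(t + ε)² ≤ ε`. -/
lemma exists_finiteRank_approx [CompleteSpace E] (s : Finset E) {ε : ℝ} (hε : 0 < ε) :
    ∃ t : E ⊗[ℂ] Conj E, IsSelfAdjoint (finiteRank A E t) ∧ ‖finiteRank A E t‖ ≤ 1 ∧
      ∀ x ∈ s, ‖(finiteRank A E t).1 x - x‖ ^ 2 ≤ ε := by
  set k : Adjointable A E E := ∑ x ∈ s, rankOne A x x with hk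
  have hk0 : 0 ≤ k := Finset.sum_nonneg fun x _ ↦ rankOne_self_nonneg x
  have hks : IsSelfAdjoint k := .of_nonneg hk0
  have hpos : ∀ t ∈ spectrum ℝ k, 0 < t + ε := fun t ht ↦ by
    linarith [spectrum_nonneg_of_nonneg hk0 ht]
  have hcont : ContinuousOn (fun t : ℝ ↦ (t + ε)⁻¹) (spectrum ℝ k) :=
    (continuous_id.add continuous_const).continuousOn.inv₀ fun t ht ↦ (hpos t ht).ne'
  set v : Adjointable A E E := cfc (fun t : ℝ ↦ (t + ε)⁻¹) k with hv
  have hvs : star v = v := (cfc_predicate (fun t : ℝ ↦ (t + ε)⁻¹) k : IsSelfAdjoint v).star_eq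
  have hkv : k * v = cfc (fun t : ℝ ↦ t * (t + ε)⁻¹) k := by
    rw [cfc_mul (fun t : ℝ ↦ t) _ k continuousOn_id hcont, cfc_id' ℝ k]
  have hv1 : 1 - k * v = cfc (fun t : ℝ ↦ ε * (t + ε)⁻¹) k := by
    rw [hkv, ← cfc_const_one ℝ k, ← cfc_sub (fun _ : ℝ ↦ 1) (fun t : ℝ ↦ t * (t + ε)⁻¹) k
      continuousOn_const (continuousOn_id.mul hcont)]
    refine cfc_congr fun t ht ↦ ?_
    have := (hpos t ht).ne'
    field_simp
    ring
  have hrk : finiteRank A E (∑ x ∈ s, x ⊗ₜ Conj.mk (v.1 x)) = k * v := by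
    rw [map_sum, hk, Finset.sum_mul]
    refine Finset.sum_congr rfl fun x _ ↦ ?_
    rw [finiteRank_tmul, rankOne_mul, ← Adjointable.star_def, hvs]
  have hus : IsSelfAdjoint (k * v) := by rw [hkv]; exact cfc_predicate _ k
  have hnorm : ‖(1 - k * v) * k * star (1 - k * v)‖ ≤ ε := by
    have hc1 : ContinuousOn (fun t : ℝ ↦ ε * (t + ε)⁻¹) (spectrum ℝ k) :=
      continuousOn_const.mul hcont
    have h1 : star (1 - k * v) = 1 - k * v := by rw [star_sub, star_one, hus.star_eq]
    have h2 : (1 - k * v) * k * (1 - k * v) =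
        cfc (fun t : ℝ ↦ ε * (t + ε)⁻¹ * t * (ε * (t + ε)⁻¹)) k := by
      rw [cfc_mul (fun t : ℝ ↦ ε * (t + ε)⁻¹ * t) _ k (hc1.mul continuousOn_id) hc1,
        cfc_mul _ (fun t : ℝ ↦ t) k hc1 continuousOn_id, cfc_id' ℝ k, hv1]
    rw [h1, h2]
    refine norm_cfc_le hε.le fun t ht ↦ ?_
    have h0 := spectrum_nonneg_of_nonneg hk0 ht
    have h3 := hpos t ht
    rw [Real.norm_of_nonneg (by positivity)]
    have h4 : ε * (t + ε)⁻¹ ≤ 1 := by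
      rw [← div_eq_mul_inv, div_le_one h3]; linarith
    have h5 : t * (ε * (t + ε)⁻¹) ≤ ε := by
      rw [← div_eq_mul_inv, ← mul_div_assoc, div_le_iff₀ h3]; nlinarith
    calc _ = ε * (t + ε)⁻¹ * (t * (ε * (t + ε)⁻¹)) := by ring
      _ ≤ 1 * (t * (ε * (t + ε)⁻¹)) := by gcongr
      _ ≤ ε := by rwa [one_mul]
  refine ⟨∑ x ∈ s, x ⊗ₜ Conj.mk (v.1 x), ?_, ?_, fun x hx ↦ ?_⟩
  · rwa [hrk]
  · rw [hrk, hkv]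
    refine norm_cfc_le zero_le_one fun t ht ↦ ?_
    have h0 := spectrum_nonneg_of_nonneg hk0 ht
    have h3 := hpos t ht
    rw [Real.norm_of_nonneg (by positivity), ← div_eq_mul_inv, div_le_one h3]
    linarith
  · rw [hrk, norm_sub_rev]
    have h6 : rankOne A x x ≤ k :=
      Finset.single_le_sum (f := fun x ↦ rankOne A x x) (fun x _ ↦ rankOne_self_nonneg x) hx
    have h7 : x - (k * v).1 x = (1 - k * v).1 x := rfl
    have h8 : rankOne A ((1 - k * v).1 x) ((1 - k * v).1 x) =
        (1 - k * v) * rankOne A x x * star (1 - k * v) := by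
      rw [mul_rankOne, rankOne_mul, ← Adjointable.star_def, star_star]
    rw [h7]
    refine (sq_norm_le_norm_rankOne A _).trans (le_trans ?_ hnorm)
    refine CStarAlgebra.norm_le_norm_of_nonneg_of_le (rankOne_self_nonneg _) ?_
    rw [h8]
    exact star_right_conjugate_le_conjugate h6 _

variable (A E) in
/-- The filter of the nets of self-adjoint finite-rank contractions that converge strongly to the
identity. -/
def finiteRankUnit : Filter (E ⊗[ℂ] Conj E) :=
  comap (fun t (x : E) ↦ (finiteRank A E t).1 x) (𝓝 id) ⊓
    𝓟 {t | IsSelfAdjoint (finiteRank A E t) ∧ ‖finiteRank A E t‖ ≤ 1}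

lemma tendsto_finiteRankUnit (x : E) :
    Tendsto (fun t ↦ (finiteRank A E t).1 x) (finiteRankUnit A E) (𝓝 x) :=
  (tendsto_pi_nhds.mp (tendsto_comap (f := fun t (x : E) ↦ (finiteRank A E t).1 x)) x).mono_left
    inf_le_left

lemma eventually_finiteRankUnit : ∀ᶠ t in finiteRankUnit A E,
    IsSelfAdjoint (finiteRank A E t) ∧ ‖finiteRank A E t‖ ≤ 1 :=
  mem_inf_of_right (mem_principal_self _)

instance [CompleteSpace E] : (finiteRankUnit A E).NeBot := by
  rw [finiteRankUnit, inf_principal_neBot_iff]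
  intro U hU
  obtain ⟨V, hV, hVU⟩ := mem_comap.mp hU
  rw [nhds_pi, mem_pi] at hV
  obtain ⟨I, hI, W, hW, hWV⟩ := hV
  -- A basic neighbourhood constrains only finitely many vectors, so a single radius serves for all
  -- of them.
  have h1 : ∃ ε > 0, ∀ i ∈ I, Metric.ball i ε ⊆ W i := by
    choose ε hε hεW using fun i ↦ Metric.mem_nhds_iff.mp (hW i)
    rcases I.eq_empty_or_nonempty with rfl | hne
    · exact ⟨1, one_pos, by simp⟩
    · obtain ⟨j, _, hj⟩ := hI.exists_minimalFor ε I hne |>.imp fun j h ↦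
        And.intro h.1 fun i hi ↦ (le_total (ε j) (ε i)).elim id (fun h' ↦ h.2 hi h')
      exact ⟨ε j, hε j, fun i hi ↦ (Metric.ball_subset_ball (hj i hi)).trans (hεW i)⟩
  obtain ⟨ε, hε, hεW⟩ := h1
  obtain ⟨t, ht1, ht2, ht3⟩ := exists_finiteRank_approx (A := A) hI.toFinset
    (ε := (ε / 2) ^ 2) (by positivity)
  refine ⟨t, hVU (hWV fun i hi ↦ hεW i hi ?_), ht1, ht2⟩
  rw [Metric.mem_ball, dist_eq_norm]
  have := (pow_le_pow_iff_left₀ (norm_nonneg _) (by positivity) two_ne_zero).mp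
    (ht3 i (hI.mem_toFinset.mpr hi))
  linarith

end FiniteRank

/-! ### Action of the unitization -/

section UnitizationAction

variable {A E : Type*} [NonUnitalCStarAlgebra A] [PartialOrder A]
  [NormedAddCommGroup E] [NormedSpace ℂ E] [SMul A E] [CStarModule A E]

variable (E) in
/-- The action of the unitization of `A` on a Hilbert `A`-module. -/
def unitizationSMul (u : Unitization ℂ A) : E →ₗ[ℂ] E := u.fst • LinearMap.id + smulLin E u.snd

lemma unitizationSMul_apply (u : Unitization ℂ A) (x : E) :
    unitizationSMul E u x = u.fst • x + u.snd • x := rfl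

lemma unitizationSMul_mul (u v : Unitization ℂ A) (x : E) :
    unitizationSMul E (u * v) x = unitizationSMul E u (unitizationSMul E v x) :=
  ext_inner_left (A := A) fun z ↦ by
    simp only [unitizationSMul_apply, Unitization.fst_mul, Unitization.snd_mul,
      CStarModule.inner_add_right, CStarModule.inner_smul_right_complex,
      CStarModule.inner_op_smul_right, add_mul, mul_add, smul_add, smul_smul, mul_assoc,
      smul_mul_assoc, mul_smul_comm]
    abel

lemma unitizationSMul_add (u v : Unitization ℂ A) (x : E) :
    unitizationSMul E (u + v) x = unitizationSMul E u x + unitizationSMul E v x := by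
  simp only [unitizationSMul_apply, Unitization.fst_add, Unitization.snd_add, add_smul,
    add_smul_mod]
  abel

lemma unitizationSMul_algebraMap (c : ℝ) (x : E) :
    unitizationSMul E (algebraMap ℝ (Unitization ℂ A) c) x = (c : ℂ) • x :=
  ext_inner_left (A := A) fun z ↦ by
    rw [Algebra.algebraMap_eq_smul_one]
    simp [unitizationSMul_apply]

lemma unitizationSMul_inr (a : A) (x : E) : unitizationSMul E (a : Unitization ℂ A) x = a • x :=
  ext_inner_left (A := A) fun z ↦ by simp [unitizationSMul_apply]

/-- This relation makes `u` and `star u` act as mutual adjoints for the form on `Ē ⊗ F`. -/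
lemma rankOne_unitizationSMul [StarOrderedRing A] (u : Unitization ℂ A) (x y : E) :
    rankOne A (unitizationSMul E u x) y = rankOne A x (unitizationSMul E (star u) y) := by
  simp only [unitizationSMul_apply, rankOne_add_left, rankOne_add_right, rankOne_smul_left,
    rankOne_smul_right, rankOne_smul_smul]
  refine congrArg₂ (· + ·) ?_ rfl
  simp

end UnitizationAction

/-! ### The correspondence built from `Ē ⊗ F` -/

section DualModule

variable {A A' E F : Type*}
  [NonUnitalCStarAlgebra A] [PartialOrder A] [StarOrderedRing A]
  [NonUnitalCStarAlgebra A'] [PartialOrder A'] [StarOrderedRing A']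
  [NormedAddCommGroup E] [NormedSpace ℂ E] [SMul A E] [CStarModule A E] [CompleteSpace E]
  [NormedAddCommGroup F] [NormedSpace ℂ F] [SMul A' F] [CStarModule A' F] [CompleteSpace F]

lemma CompletelyPositive.exists_norm_le (T : Adjointable A E E →CP Adjointable A' F F) :
    ∃ M : ℝ, 0 < M ∧ ∀ a, ‖T a‖ ≤ M * ‖a‖ := by
  obtain ⟨C, hC⟩ := PositiveLinearMap.exists_norm_apply_le (.ofClass T)
  exact ⟨C + 1, by positivity, fun a ↦ (hC a).trans
    (mul_le_mul_of_nonneg_right (by linarith) (norm_nonneg _))⟩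

lemma CompletelyPositive.map_star (T : Adjointable A E E →CP Adjointable A' F F)
    (a : Adjointable A E E) : T (star a) = star (T a) :=
  StarHomClass.map_star (PositiveLinearMap.ofClass T) a

/-- The vector space `Ē ⊗ F`, to be equipped with the semi-inner product
`⟪x̄ ⊗ f, x̄' ⊗ f'⟫ = ⟪f, T (x x'*) f'⟫`. -/
def DualTensor (_ : Adjointable A E E →CP Adjointable A' F F) := Conj E ⊗[ℂ] F

variable (T : Adjointable A E E →CP Adjointable A' F F)

namespace DualTensor

instance : AddCommGroup (DualTensor T) := inferInstanceAs (AddCommGroup (Conj E ⊗[ℂ] F))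

instance : Module ℂ (DualTensor T) := inferInstanceAs (Module ℂ (Conj E ⊗[ℂ] F))

instance : SMul A' (DualTensor T) where
  smul c z := LinearMap.lTensor (Conj E) (smulLin F c) z

/-- The sesquilinear form with `⟪x̄ ⊗ f, x̄' ⊗ f'⟫ = ⟪f, T (x x'*) f'⟫`. -/
def form : DualTensor T →ₗ⋆[ℂ] DualTensor T →ₗ[ℂ] A' :=
  TensorProduct.lift <| LinearMap.mk₂'ₛₗ (starRingEnd ℂ) (starRingEnd ℂ)
    (fun x f ↦ TensorProduct.lift <| LinearMap.mk₂ ℂ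
      (fun x' f' ↦ inner A' f ((T (rankOne A (Conj.out x) (Conj.out x'))).1 f'))
      (fun _ _ _ ↦ by simp [rankOne_add_right])
      (fun _ _ _ ↦ by simp [rankOne_smul_right])
      (fun _ _ _ ↦ by simp) (fun _ _ _ ↦ by simp))
    (fun _ _ _ ↦ TensorProduct.ext' fun _ _ ↦ by simp [rankOne_add_left]; rfl)
    (fun _ _ _ ↦ TensorProduct.ext' fun _ _ ↦ by simp [rankOne_smul_left]; rfl)
    (fun _ _ _ ↦ TensorProduct.ext' fun _ _ ↦ by simp; rfl)
    (fun _ _ _ ↦ TensorProduct.ext' fun _ _ ↦ by simp; rfl)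

instance : Inner A' (DualTensor T) where
  inner z w := form T z w

variable {T}

/-- The elementary tensor `x̄ ⊗ f`. -/
def tmul (x : E) (f : F) : DualTensor T := Conj.mk x ⊗ₜ[ℂ] f

lemma form_tmul (x x' : E) (f f' : F) :
    form T (tmul x f) (tmul x' f') = inner A' f ((T (rankOne A x x')).1 f') := rfl

lemma smul_tmul (c : A') (x : E) (f : F) : c • tmul (T := T) x f = tmul x (c • f) := rfl

lemma induction_on {p : DualTensor T → Prop} (z : DualTensor T) (zero : p 0)
    (tmul : ∀ x f, p (tmul x f)) (add : ∀ z w, p z → p w → p (z + w)) : p z :=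
  TensorProduct.induction_on z zero (fun x f ↦ tmul (Conj.out x) f) add

lemma form_smul (c : A') (z w : DualTensor T) : form T z (c • w) = c * form T z w := by
  have hadd : ∀ w₁ w₂ : DualTensor T, c • (w₁ + w₂) = c • w₁ + c • w₂ :=
    fun w₁ w₂ ↦ map_add (LinearMap.lTensor (Conj E) (smulLin F c)) w₁ w₂
  have hzero : c • (0 : DualTensor T) = 0 := map_zero (LinearMap.lTensor (Conj E) (smulLin F c))
  induction w using induction_on with
  | zero => simp [hzero]
  | add w₁ w₂ h₁ h₂ => rw [hadd, map_add, map_add, h₁, h₂, mul_add]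
  | tmul x' f' =>
    induction z using induction_on with
    | zero => simp
    | add z₁ z₂ h₁ h₂ => rw [map_add, LinearMap.add_apply, LinearMap.add_apply, h₁, h₂, mul_add]
    | tmul x f =>
      rw [smul_tmul, form_tmul, form_tmul, Adjointable.map_smul_mod,
        CStarModule.inner_op_smul_right]

lemma star_form (z w : DualTensor T) : star (form T z w) = form T w z := by
  induction w using induction_on with
  | zero => simp
  | add w₁ w₂ h₁ h₂ => rw [map_add, map_add, LinearMap.add_apply, star_add, h₁, h₂]
  | tmul x' f' =>
    induction z using induction_on with
    | zero => simp
    | add z₁ z₂ h₁ h₂ => rw [map_add, map_add, LinearMap.add_apply, star_add, h₁, h₂]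
    | tmul x f =>
      rw [form_tmul, form_tmul, CStarModule.star_inner, ← Adjointable.inner_adj_right,
        ← Adjointable.star_def, ← CompletelyPositive.map_star, star_rankOne]

lemma form_self_nonneg (z : DualTensor T) : 0 ≤ form T z z := by
  obtain ⟨k, x, y, hz⟩ : ∃ (k : ℕ) (x : Fin k → E) (y : Fin k → F),
      z = ∑ i, tmul (x i) (y i) := by
    obtain ⟨k, x, y, hz⟩ := TensorProduct.exists_sum_tmul_eq z
    exact ⟨k, fun i ↦ Conj.out (x i), y, hz⟩
  -- Complete positivity enters here: `(T(xᵢxⱼ*))` is positive, hence of the form `N*N`, and the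
  -- form at `z` becomes a sum of squares over the rows of `N`.
  have hG := T.map_cstarMatrix_nonneg' k _ (rankOne_matrix_nonneg x)
  obtain ⟨N, hN⟩ := exists_eq_star_mul_self hG
  have h1 : ∀ i j, T (rankOne A (x i) (x j)) = ∑ l, star (N l i) * N l j := by
    intro i j
    have := congrFun (congrFun hN i) j
    exact this.trans (by rw [CStarMatrix.mul_apply]; rfl)
  have h2 : form T z z = ∑ l, inner A' (∑ i, (N l i).1 (y i)) (∑ i, (N l i).1 (y i)) := by
    have h3 : ∀ i j, form T (tmul (x i) (y i)) (tmul (x j) (y j)) =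
        ∑ l, inner A' ((N l i).1 (y i)) ((N l j).1 (y j)) := fun i j ↦ by
      rw [form_tmul, h1, AddSubmonoidClass.coe_finsetSum, sum_apply, CStarModule.inner_sum_right]
      exact Finset.sum_congr rfl fun l _ ↦ Adjointable.inner_adj_right _ _ _
    simp only [hz, map_sum, LinearMap.sum_apply, h3, CStarModule.inner_sum_right,
      CStarModule.inner_sum_left]
    rw [Finset.sum_comm]
    refine (Finset.sum_congr rfl fun i _ ↦ Finset.sum_comm).trans ?_
    rw [Finset.sum_comm]
    exact Finset.sum_congr rfl fun l _ ↦ Finset.sum_comm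
  rw [h2]
  exact Finset.sum_nonneg fun l _ ↦ CStarModule.inner_self_nonneg

instance : Norm (DualTensor T) where
  norm z := √‖inner A' z z‖

instance : SemiCStarModule A' (DualTensor T) where
  inner_add_right' := map_add _ _ _
  inner_self_nonneg' := form_self_nonneg _
  inner_smul_right' := form_smul _ _ _
  inner_smul_right_complex' := map_smul _ _ _
  star_inner' := star_form
  norm_eq' _ := rfl

instance : SeminormedAddCommGroup (DualTensor T) :=
  SeminormedAddCommGroup.ofCore (SemiCStarModule.core A' (DualTensor T))

instance : NormedSpace ℂ (DualTensor T) where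
  norm_smul_le c z := ((SemiCStarModule.core A' (DualTensor T)).norm_smul c z).le

instance : UniformContinuousConstSMul A' (DualTensor T) :=
  SemiCStarModule.uniformContinuousConstSMul _ _

variable (T) in
/-- The map `x̄ ⊗ f ↦ (u x)‾ ⊗ f`. -/
def act (u : Unitization ℂ A) : DualTensor T →ₗ[ℂ] DualTensor T :=
  LinearMap.rTensor F ((Conj.mk.comp (unitizationSMul E u)).comp Conj.out : Conj E →ₗ[ℂ] Conj E)

lemma act_tmul (u : Unitization ℂ A) (x : E) (f : F) :
    act T u (tmul x f) = tmul (unitizationSMul E u x) f := rfl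

lemma form_act (u : Unitization ℂ A) (z w : DualTensor T) :
    form T (act T u z) w = form T z (act T (star u) w) := by
  induction w using induction_on with
  | zero => simp
  | add w₁ w₂ h₁ h₂ => rw [map_add, map_add, map_add, h₁, h₂]
  | tmul x' f' =>
    induction z using induction_on with
    | zero => simp
    | add z₁ z₂ h₁ h₂ =>
      rw [map_add, map_add, map_add, LinearMap.add_apply, LinearMap.add_apply, h₁, h₂]
    | tmul x f => rw [act_tmul, act_tmul, form_tmul, form_tmul, rankOne_unitizationSMul]

/-- In the unitization `‖u‖² - u*u = c*c`, so `‖u‖²⟪z, z⟫` exceeds `⟪uz, uz⟫` by `⟪cz, cz⟫ ≥ 0`. The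
algebra itself may have no unit, which is why the action is set up for its unitization. -/
lemma norm_act_le (u : Unitization ℂ A) (z : DualTensor T) : ‖act T u z‖ ≤ ‖u‖ * ‖z‖ := by
  obtain ⟨c, hc⟩ := CStarAlgebra.nonneg_iff_eq_star_mul_self.mp
    (sub_nonneg.mpr (CStarAlgebra.star_mul_le_algebraMap_norm_sq (a := u)))
  have hz : act T (star u) (act T u z) + act T (star c) (act T c z) =
      ((‖u‖ ^ 2 : ℝ) : ℂ) • z := by
    induction z using induction_on with
    | zero => simp
    | add z₁ z₂ h₁ h₂ => rw [smul_add, ← h₁, ← h₂]; simp only [map_add]; abel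
    | tmul x f =>
      simp only [act_tmul, ← unitizationSMul_mul]
      have h : unitizationSMul E (star u * u) x + unitizationSMul E (star c * c) x =
          ((‖u‖ ^ 2 : ℝ) : ℂ) • x := by
        rw [← unitizationSMul_add, ← hc, add_sub_cancel, unitizationSMul_algebraMap]
      refine (TensorProduct.add_tmul _ _ _).symm.trans ?_
      rw [← map_add, h, LinearMap.map_smulₛₗ, Complex.conj_ofReal]
      exact (TensorProduct.smul_tmul' _ _ _).symm
  have h1 : form T (act T u z) (act T u z) + form T (act T c z) (act T c z) =
      (‖u‖ ^ 2) • form T z z := by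
    rw [form_act, form_act, ← map_add, hz, map_smul]
    rfl
  have h2 : form T (act T u z) (act T u z) ≤ (‖u‖ ^ 2) • form T z z := by
    rw [← h1]; exact le_add_of_nonneg_right (form_self_nonneg _)
  have h3 := CStarAlgebra.norm_le_norm_of_nonneg_of_le (form_self_nonneg _) h2
  refine (pow_le_pow_iff_left₀ (norm_nonneg _) (by positivity) two_ne_zero).mp ?_
  rw [mul_pow, SemiCStarModule.norm_sq' (A := A'), SemiCStarModule.norm_sq' (A := A') z]
  refine h3.trans_eq ((norm_smul (‖u‖ ^ 2) (form T z z)).trans ?_)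
  rw [Real.norm_of_nonneg (by positivity)]
  rfl

variable (T) in
/-- The map `x̄ ⊗ f ↦ (a x)‾ ⊗ f` as a bounded operator. -/
def actCLM (a : A) : DualTensor T →L[ℂ] DualTensor T :=
  (act T (a : Unitization ℂ A)).mkContinuous ‖(a : Unitization ℂ A)‖ (norm_act_le _)

lemma actCLM_tmul (a : A) (x : E) (f : F) : actCLM T a (tmul x f) = tmul (a • x) f := by
  rw [← unitizationSMul_inr]; rfl

lemma inner_actCLM_completion (a : A) (z w : Completion (DualTensor T)) :
    inner A' ((actCLM T a).completion z) w = inner A' z ((actCLM T (star a)).completion w) := by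
  induction z, w using Completion.induction_on₂ with
  | hp =>
    exact isClosed_eq
      (CStarModule.continuous_inner.comp (by fun_prop : Continuous fun p :
        Completion (DualTensor T) × Completion (DualTensor T) ↦ ((actCLM T a).completion p.1, p.2)))
      (CStarModule.continuous_inner.comp (by fun_prop : Continuous fun p :
        Completion (DualTensor T) × Completion (DualTensor T) ↦
          (p.1, (actCLM T (star a)).completion p.2)))
  | ih z w =>
    rw [ContinuousLinearMap.completion_apply_coe, ContinuousLinearMap.completion_apply_coe,
      SemiCStarModule.inner_coe, SemiCStarModule.inner_coe]
    refine (form_act (a : Unitization ℂ A) z w).trans ?_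
    rw [← Unitization.inr_star]
    rfl

/-- The class of `x̄ ⊗ f` in the completion. -/
def mk (x : E) (f : F) : Completion (DualTensor T) := (tmul x f : DualTensor T)

variable (T) in
lemma inner_mk (x x' : E) (f f' : F) : inner A' (mk (T := T) x f) (mk (T := T) x' f') =
    inner A' f ((T (rankOne A x x')).1 f') := SemiCStarModule.inner_coe _ _

variable (T) in
/-- `x̄ ⊗ f` as a sesquilinear function of `x` and `f`. -/
def mkLin : E →ₗ⋆[ℂ] F →ₗ[ℂ] Completion (DualTensor T) :=
  LinearMap.mk₂'ₛₗ (starRingEnd ℂ) (RingHom.id ℂ) mk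
    (fun x y f ↦ by
      simp only [mk, tmul, map_add]
      exact (congrArg _ (TensorProduct.add_tmul _ _ _)).trans (Completion.coe_add _ _))
    (fun c x f ↦ by
      simp only [mk, tmul, LinearMap.map_smulₛₗ]
      exact (congrArg _ (TensorProduct.smul_tmul' _ _ _).symm).trans
        (map_smul (Completion.toComplL (𝕜 := ℂ) (E := DualTensor T)) _ _))
    (fun x f g ↦ (congrArg _ (TensorProduct.tmul_add _ _ _)).trans (Completion.coe_add _ _))
    (fun c x f ↦ (congrArg _ (TensorProduct.tmul_smul _ _ _)).trans
        (map_smul (Completion.toComplL (𝕜 := ℂ) (E := DualTensor T)) _ _))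

lemma mkLin_apply (x : E) (f : F) : mkLin T x f = mk x f := rfl

lemma dense_span_mk : (Submodule.span ℂ
    {z : Completion (DualTensor T) | ∃ x f, z = mk x f}).topologicalClosure = ⊤ := by
  rw [← Submodule.dense_iff_topologicalClosure_eq_top]
  refine Completion.denseRange_coe.mono ?_
  rintro _ ⟨z, rfl⟩
  induction z using induction_on with
  | zero => exact Submodule.zero_mem _
  | add z₁ z₂ h₁ h₂ => rw [Completion.coe_add]; exact Submodule.add_mem _ h₁ h₂
  | tmul x y => exact Submodule.subset_span ⟨x, y, rfl⟩

lemma ext_mk {G : Type*} [NormedAddCommGroup G] [NormedSpace ℂ G]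
    {φ ψ : Completion (DualTensor T) →L[ℂ] G} (h : ∀ x f, φ (mk x f) = ψ (mk x f)) : φ = ψ :=
  ContinuousLinearMap.ext_on (Submodule.dense_iff_topologicalClosure_eq_top.mpr dense_span_mk)
    (by rintro _ ⟨x, f, rfl⟩; exact h x f)

variable (T) in
lemma exists_norm_mk_le : ∃ M : ℝ, 0 < M ∧
    ∀ x f, ‖mk (T := T) x f‖ ≤ M * ‖x‖ * ‖f‖ := by
  obtain ⟨M, hM, h⟩ := CompletelyPositive.exists_norm_le T
  refine ⟨√M, Real.sqrt_pos.mpr hM, fun x f ↦ ?_⟩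
  refine (pow_le_pow_iff_left₀ (norm_nonneg _) (by positivity) two_ne_zero).mp ?_
  rw [CStarModule.norm_sq_eq A', inner_mk, mul_pow, mul_pow, Real.sq_sqrt hM.le]
  calc _ ≤ ‖f‖ * ‖(T (rankOne A x x)).1 f‖ := CStarModule.norm_inner_le F
    _ ≤ ‖f‖ * (M * (‖x‖ * ‖x‖) * ‖f‖) := by
        gcongr
        refine ((T (rankOne A x x)).1.le_opNorm f).trans ?_
        gcongr
        exact (h _).trans (by gcongr; exact norm_rankOne_le A x x)
    _ = _ := by ring

variable (T) in
/-- The operator `x̄ ⊗ f ↦ (a x)‾ ⊗ f` in `𝓑ᵃ`. -/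
def actAdjointable (a : A) :
    Adjointable A' (Completion (DualTensor T)) (Completion (DualTensor T)) :=
  ⟨(actCLM T a).completion, (actCLM T (star a)).completion, inner_actCLM_completion a⟩

lemma actAdjointable_mk (a : A) (x : E) (f : F) :
    (actAdjointable T a).1 (mk x f) = mk (a • x) f := by
  refine (ContinuousLinearMap.completion_apply_coe (actCLM T a) (tmul x f)).trans ?_
  rw [actCLM_tmul]
  rfl

lemma actAdjointable_star (a : A) : actAdjointable T (star a) = star (actAdjointable T a) :=
  Adjointable.eq_adj (inner_actCLM_completion a)

end DualTensor

/-- The left action `b (x̄ ⊗ f) = (x b*)‾ ⊗ f`. -/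
def dualLeftAction {B : Type*} [NonUnitalCStarAlgebra B] [PartialOrder B] [StarOrderedRing B]
    {E : Type*} [NormedAddCommGroup E] [NormedSpace ℂ E] [SMul Bᵐᵒᵖ E] [CStarModule Bᵐᵒᵖ E]
    [CompleteSpace E] (T : Adjointable Bᵐᵒᵖ E E →CP Adjointable A' F F) :
    B →⋆ₙₐ[ℂ] Adjointable A' (Completion (DualTensor T)) (Completion (DualTensor T)) where
  -- The star offsets both the conjugate-linearity of `x ↦ x̄` and the reversal of products by `op`,
  -- so the result is linear and multiplicative in `b`.
  toFun := fun b ↦ DualTensor.actAdjointable T (MulOpposite.op (star b))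
  map_smul' := fun c b ↦ Subtype.ext <| DualTensor.ext_mk fun x f ↦ by
    change (DualTensor.actAdjointable T _).1 _ = c • (DualTensor.actAdjointable T _).1 _
    rw [DualTensor.actAdjointable_mk, DualTensor.actAdjointable_mk, ← DualTensor.mkLin_apply,
      star_smul, MulOpposite.op_smul, smul_smul_mod, LinearMap.map_smulₛₗ, starRingEnd_apply,
      star_star]
    rfl
  map_zero' := Subtype.ext <| DualTensor.ext_mk fun x f ↦ by
    change (DualTensor.actAdjointable T _).1 _ = 0
    have h : (0 : Bᵐᵒᵖ) • x = 0 := ext_inner_left (A := Bᵐᵒᵖ) fun z ↦ by simp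
    rw [DualTensor.actAdjointable_mk, ← DualTensor.mkLin_apply, star_zero, MulOpposite.op_zero,
      h, map_zero, LinearMap.zero_apply]
  map_add' := fun b b' ↦ Subtype.ext <| DualTensor.ext_mk fun x f ↦ by
    change (DualTensor.actAdjointable T _).1 _ =
      (DualTensor.actAdjointable T _).1 _ + (DualTensor.actAdjointable T _).1 _
    simp only [DualTensor.actAdjointable_mk, star_add, MulOpposite.op_add, add_smul_mod]
    simp only [← DualTensor.mkLin_apply, map_add, LinearMap.add_apply]
  map_mul' := fun b b' ↦ Subtype.ext <| DualTensor.ext_mk fun x f ↦ by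
    change (DualTensor.actAdjointable T _).1 _ =
      (DualTensor.actAdjointable T _).1 ((DualTensor.actAdjointable T _).1 _)
    simp only [DualTensor.actAdjointable_mk, star_mul, MulOpposite.op_mul, mul_smul_mod]
  map_star' := fun b ↦
    DualTensor.actAdjointable_star (T := T) (MulOpposite.op (star b))

/-- The `B`-`C` correspondence with `⟪x̄ ⊗ f, x̄' ⊗ f'⟫ = ⟪f, T (x x'*) f'⟫` and the left action
`b (x̄ ⊗ f) = (x b*)‾ ⊗ f`. -/
def dualCorrespondence {B : Type u} [NonUnitalCStarAlgebra B] [PartialOrder B] [StarOrderedRing B]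
    {C : Type v} [NonUnitalCStarAlgebra C] [PartialOrder C] [StarOrderedRing C]
    {E : Type w} [NormedAddCommGroup E] [NormedSpace ℂ E] [SMul Bᵐᵒᵖ E] [CStarModule Bᵐᵒᵖ E]
    [CompleteSpace E]
    {F : Type w'} [NormedAddCommGroup F] [NormedSpace ℂ F] [SMul Cᵐᵒᵖ F] [CStarModule Cᵐᵒᵖ F]
    [CompleteSpace F] (T : Adjointable Bᵐᵒᵖ E E →CP Adjointable Cᵐᵒᵖ F F) :
    Correspondence.{u, v, max w w'} B C where
  carrier := Completion (DualTensor T)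
  leftAction := dualLeftAction T
  nondegenerate := by
    refine top_le_iff.mp (le_of_eq_of_le DualTensor.dense_span_mk.symm ?_)
    refine Submodule.topologicalClosure_minimal _ (Submodule.span_le.mpr ?_)
      (Submodule.isClosed_topologicalClosure _)
    rintro _ ⟨x, f, rfl⟩
    obtain ⟨M, hM, hmk⟩ := DualTensor.exists_norm_mk_le T
    -- For an approximate unit `e`, the vectors `(xe)‾ ⊗ f = e*(x̄ ⊗ f)` lie in the range of the
    -- action and converge to `x̄ ⊗ f`.
    refine mem_closure_of_tendsto (b := CStarAlgebra.approximateUnit Bᵐᵒᵖ)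
      (f := fun e : Bᵐᵒᵖ ↦ DualTensor.mk (T := T) (e • x) f) ?_ (Eventually.of_forall fun e ↦ ?_)
    · rw [tendsto_iff_norm_sub_tendsto_zero]
      have h := (tendsto_sub_nhds_zero_iff.mpr
        (tendsto_approximateUnit_smul (A := Bᵐᵒᵖ) x)).norm.const_mul M |>.mul_const ‖f‖
      refine squeeze_zero (fun _ ↦ norm_nonneg _) (fun e ↦ ?_) (by simpa using h)
      rw [← DualTensor.mkLin_apply, ← DualTensor.mkLin_apply, ← LinearMap.sub_apply, ← map_sub]
      exact hmk _ _
    · refine Submodule.subset_span ⟨star e.unop, DualTensor.mk x f, ?_⟩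
      change _ = (DualTensor.actAdjointable T _).1 _
      rw [DualTensor.actAdjointable_mk, star_star, MulOpposite.op_unop]

end DualModule

/-! ### Continuity of elementary tensors and a domination estimate -/

section Tmul

variable {B : Type u} {C : Type v} [NonUnitalCStarAlgebra B] [PartialOrder B] [StarOrderedRing B]
  [NonUnitalCStarAlgebra C] [PartialOrder C] [StarOrderedRing C]
  {E : Type w'} [NormedAddCommGroup E] [NormedSpace ℂ E] [SMul Bᵐᵒᵖ E] [CStarModule Bᵐᵒᵖ E]

/-- The elementary tensor `x ⊙ y` as a bilinear function. -/
def tmulLin (𝓕 : Correspondence.{u, v, w} B C) :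
    E →ₗ[ℂ] 𝓕.carrier →ₗ[ℂ] InteriorTensor E 𝓕 :=
  (TensorProduct.mk ℂ E 𝓕.carrier).compr₂
    (Completion.toComplL (𝕜 := ℂ) (E := PreTensor E 𝓕)).toLinearMap

lemma tmulLin_apply {𝓕 : Correspondence.{u, v, w} B C} (x : E) (y : 𝓕.carrier) :
    tmulLin 𝓕 x y = tmul x y := rfl

lemma continuous_tmul {𝓕 : Correspondence.{u, v, w} B C} (x : E) :
    Continuous fun y : 𝓕.carrier ↦ tmul (𝓕 := 𝓕) x y := by
  set φ := 𝓕.leftAction (inner Bᵐᵒᵖ x x).unop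
  refine AddMonoidHomClass.continuous_of_bound (tmulLin 𝓕 x) (√‖φ‖) fun y ↦ ?_
  refine (pow_le_pow_iff_left₀ (norm_nonneg _) (by positivity) two_ne_zero).mp ?_
  rw [tmulLin_apply, CStarModule.norm_sq_eq Cᵐᵒᵖ, inner_tmul, mul_pow,
    Real.sq_sqrt (norm_nonneg _)]
  calc _ ≤ ‖y‖ * ‖φ.1 y‖ := CStarModule.norm_inner_le _
    _ ≤ ‖y‖ * (‖φ‖ * ‖y‖) := by gcongr; exact φ.1.le_opNorm y
    _ = _ := by ring

end Tmul

/-- Conjugating `q ≤ Mp` by `q` gives `q³ ≤ M qpq`, hence `‖q‖⁴ = ‖q⁴‖ ≤ ‖q‖ ‖q³‖ ≤ M ‖q‖² ‖pq‖`. It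
turns `pq → 0` into `q → 0`, although `p` need not be invertible. -/
lemma sq_norm_le_of_le_smul {A : Type*} [NonUnitalCStarAlgebra A] [PartialOrder A]
    [StarOrderedRing A] {p q : A} {M : ℝ} (hM : 0 ≤ M) (hq : 0 ≤ q) (hqp : q ≤ M • p) :
    ‖q‖ ^ 2 ≤ M * ‖p * q‖ := by
  have hs : star q = q := (IsSelfAdjoint.of_nonneg hq).star_eq
  have h2 : ‖q * q‖ = ‖q‖ * ‖q‖ := by
    nth_rewrite 1 [← hs]; exact CStarRing.norm_star_mul_self
  have h4 : ‖(q * q) * (q * q)‖ = ‖q * q‖ * ‖q * q‖ := by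
    nth_rewrite 1 [show q * q = star (q * q) by rw [star_mul, hs]]
    exact CStarRing.norm_star_mul_self
  have h3 : ‖q * q * q‖ ≤ M * (‖q‖ * ‖p * q‖) := by
    have h5 : q * q * q ≤ M • (q * (p * q)) := by
      have := star_left_conjugate_le_conjugate hqp q
      rwa [hs, mul_smul_comm, smul_mul_assoc, mul_assoc q p q] at this
    have h6 : 0 ≤ q * q * q := by
      have := star_left_conjugate_nonneg hq q
      rwa [hs] at this
    refine (CStarAlgebra.norm_le_norm_of_nonneg_of_le h6 h5).trans ?_
    rw [norm_smul, Real.norm_of_nonneg hM]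
    gcongr
    exact norm_mul_le _ _
  rcases (norm_nonneg q).eq_or_lt with h0 | h0
  · rw [← h0]; simp only [ne_eq, OfNat.ofNat_ne_zero, not_false_eq_true, zero_pow]; positivity
  · have h7 : ‖q‖ ^ 2 * ‖q‖ ^ 2 ≤ M * ‖p * q‖ * ‖q‖ ^ 2 :=
      calc ‖q‖ ^ 2 * ‖q‖ ^ 2 = ‖q * (q * q * q)‖ := by
            rw [show q * (q * q * q) = (q * q) * (q * q) by simp only [mul_assoc], h4, h2]; ring
        _ ≤ ‖q‖ * (M * (‖q‖ * ‖p * q‖)) := (norm_mul_le _ _).trans (by gcongr)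
        _ = _ := by ring
    exact le_of_mul_le_mul_right h7 (by positivity)

/-! ### Strict convergence along the approximate unit -/

section FiniteRank

variable {A E : Type*} [NonUnitalCStarAlgebra A] [PartialOrder A] [StarOrderedRing A]
  [NormedAddCommGroup E] [NormedSpace ℂ E] [SMul A E] [CStarModule A E]

lemma finiteRank_induction {p : E ⊗[ℂ] Conj E → Prop} (t : E ⊗[ℂ] Conj E) (zero : p 0)
    (tmul : ∀ x y : E, p (x ⊗ₜ Conj.mk y)) (add : ∀ s t, p s → p t → p (s + t)) : p t :=
  TensorProduct.induction_on t zero (fun x y ↦ tmul x (Conj.out y)) add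

lemma mul_finiteRank_mem (a : Adjointable A E E) (t : E ⊗[ℂ] Conj E) :
    a * finiteRank A E t ∈ compactOps A E := by
  induction t using finiteRank_induction with
  | zero => rw [map_zero, mul_zero]; exact Submodule.zero_mem _
  | tmul x y =>
    rw [finiteRank_tmul, mul_rankOne]
    exact Submodule.le_topologicalClosure _ (Submodule.subset_span ⟨_, _, rfl⟩)
  | add s t hs ht => rw [map_add, mul_add]; exact Submodule.add_mem _ hs ht

lemma eventually_norm_mul_finiteRank_le (a : Adjointable A E E) :
    ∀ᶠ t in finiteRankUnit A E, ‖a * finiteRank A E t‖ ≤ ‖a‖ := by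
  filter_upwards [eventually_finiteRankUnit] with t ht
  exact (norm_mul_le _ _).trans (mul_le_of_le_one_right (norm_nonneg _) ht.2)

/-- `a u → a` strictly, if `u` runs through the finite-rank approximate unit. -/
lemma strictTendsto_mul_finiteRank (a : Adjointable A E E) :
    StrictTendsto (fun t ↦ a * finiteRank A E t) (finiteRankUnit A E) a := by
  refine strictTendsto_of_strong (eventually_norm_mul_finiteRank_le a) (fun x ↦ ?_) fun x ↦ ?_
  · exact (a.1.continuous.tendsto x).comp (tendsto_finiteRankUnit x)
  · refine (tendsto_finiteRankUnit (A := A) ((star a).1 x)).congr' ?_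
    filter_upwards [eventually_finiteRankUnit] with t ht
    rw [star_mul, ht.1.star_eq]
    rfl

lemma eventually_norm_finiteRank_sub_le : ∀ᶠ t : (E ⊗[ℂ] Conj E) × (E ⊗[ℂ] Conj E) in
    finiteRankUnit A E ×ˢ finiteRankUnit A E, ‖finiteRank A E (t.1 - t.2)‖ ≤ 2 := by
  filter_upwards [(eventually_finiteRankUnit (A := A) (E := E)).prod_mk
    (eventually_finiteRankUnit (A := A) (E := E))] with t ht
  rw [map_sub]
  exact (norm_sub_le _ _).trans (by linarith [ht.1.2, ht.2.2])

lemma eventually_norm_star_mul_finiteRank_sub_le :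
    ∀ᶠ t : (E ⊗[ℂ] Conj E) × (E ⊗[ℂ] Conj E) in finiteRankUnit A E ×ˢ finiteRankUnit A E,
      ‖star (finiteRank A E (t.1 - t.2)) * finiteRank A E (t.1 - t.2)‖ ≤ 4 := by
  filter_upwards [eventually_norm_finiteRank_sub_le] with t ht
  rw [CStarRing.norm_star_mul_self]
  nlinarith [norm_nonneg (finiteRank A E (t.1 - t.2))]

/-- For `w = u₁ - u₂`, strong convergence `w → 0` and boundedness of `w*` give `w*w → 0` strongly;
since `w*w` is self-adjoint, this suffices. Applying `T` to `w*w` measures the Cauchy differences of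
`Ψ(u)f`. -/
lemma strictTendsto_star_mul_finiteRank_sub :
    StrictTendsto (fun t : (E ⊗[ℂ] Conj E) × (E ⊗[ℂ] Conj E) ↦
      star (finiteRank A E (t.1 - t.2)) * finiteRank A E (t.1 - t.2))
      (finiteRankUnit A E ×ˢ finiteRankUnit A E) 0 := by
  have h : ∀ x : E, Tendsto (fun t : (E ⊗[ℂ] Conj E) × (E ⊗[ℂ] Conj E) ↦
      (star (finiteRank A E (t.1 - t.2)) * finiteRank A E (t.1 - t.2)).1 x)
      (finiteRankUnit A E ×ˢ finiteRankUnit A E) (𝓝 0) := fun x ↦ by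
    have h1 : Tendsto (fun t : (E ⊗[ℂ] Conj E) × (E ⊗[ℂ] Conj E) ↦
        (finiteRank A E (t.1 - t.2)).1 x) (finiteRankUnit A E ×ˢ finiteRankUnit A E) (𝓝 0) := by
      have h0 := ((tendsto_finiteRankUnit (A := A) x).comp tendsto_fst).sub
        ((tendsto_finiteRankUnit (A := A) x).comp tendsto_snd)
      rw [sub_self] at h0
      refine h0.congr fun t ↦ ?_
      rw [map_sub]
      rfl
    refine squeeze_zero_norm' ?_ (by simpa only [norm_zero, mul_zero] using h1.norm.const_mul 2)
    filter_upwards [eventually_norm_finiteRank_sub_le] with t ht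
    set w := finiteRank A E (t.1 - t.2)
    refine ((star w).1.le_opNorm (w.1 x)).trans ?_
    gcongr
    exact (norm_star w).trans_le ht
  refine strictTendsto_of_strong eventually_norm_star_mul_finiteRank_sub_le h fun x ↦ ?_
  rw [star_zero]
  refine (h x).congr fun t ↦ ?_
  rw [star_mul, star_star]

end FiniteRank

/-! ### The intertwiner `Ξ` as a limit -/

section Main

variable {B : Type u} [NonUnitalCStarAlgebra B] [PartialOrder B] [StarOrderedRing B]
  {C : Type v} [NonUnitalCStarAlgebra C] [PartialOrder C] [StarOrderedRing C]
  {E : Type w} [NormedAddCommGroup E] [NormedSpace ℂ E] [SMul Bᵐᵒᵖ E] [CStarModule Bᵐᵒᵖ E]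
  [CompleteSpace E]
  {F : Type w'} [NormedAddCommGroup F] [NormedSpace ℂ F] [SMul Cᵐᵒᵖ F] [CStarModule Cᵐᵒᵖ F]
  [CompleteSpace F]
  (T : Adjointable Bᵐᵒᵖ E E →CP Adjointable Cᵐᵒᵖ F F)

variable (E F) in
/-- The element `x̄ ⊗ f` of the correspondence. -/
def dualMk : E →ₗ⋆[ℂ] F →ₗ[ℂ] (dualCorrespondence T).carrier := DualTensor.mkLin T

variable {T}

lemma inner_dualMk (x x' : E) (f f' : F) : inner Cᵐᵒᵖ (dualMk E F T x f) (dualMk E F T x' f') =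
    inner Cᵐᵒᵖ f ((T (rankOne Bᵐᵒᵖ x x')).1 f') := DualTensor.inner_mk T x x' f f'

lemma leftAction_dualMk (b : B) (x : E) (f : F) :
    ((dualCorrespondence T).leftAction b).1 (dualMk E F T x f) =
      dualMk E F T (MulOpposite.op (star b) • x) f := DualTensor.actAdjointable_mk _ _ _

/-- For fixed `x` the map `y ↦ x ⊙ y` is continuous, so the second factor may be restricted to a
total set. The adjoint of `Ξ` is explicit on these vectors. -/
lemma dense_span_tmul_dualMk : (Submodule.span ℂ {z : InteriorTensor E (dualCorrespondence T) |
    ∃ x y f, z = tmul x (dualMk E F T y f)}).topologicalClosure = ⊤ := by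
  refine top_le_iff.mp (le_of_eq_of_le dense_span_tmul.symm ?_)
  refine Submodule.topologicalClosure_minimal _ (Submodule.span_le.mpr ?_)
    (Submodule.isClosed_topologicalClosure _)
  rintro _ ⟨x, y, rfl⟩
  set P := (Submodule.span ℂ {z : InteriorTensor E (dualCorrespondence T) |
    ∃ x y f, z = tmul x (dualMk E F T y f)})
  have h : (Submodule.span ℂ {y : (dualCorrespondence T).carrier |
      ∃ x f, y = dualMk E F T x f}).topologicalClosure ≤
      P.topologicalClosure.comap (tmulLin (dualCorrespondence T) x) := by
    refine Submodule.topologicalClosure_minimal _ (Submodule.span_le.mpr ?_) ?_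
    · rintro _ ⟨x', f, rfl⟩
      exact Submodule.le_topologicalClosure _ (Submodule.subset_span ⟨x, x', f, rfl⟩)
    · exact P.isClosed_topologicalClosure.preimage (continuous_tmul x)
  have h' : (Submodule.span ℂ {y : (dualCorrespondence T).carrier |
      ∃ x f, y = dualMk E F T x f}).topologicalClosure = ⊤ := DualTensor.dense_span_mk
  exact h (h' ▸ Submodule.mem_top)

variable (T) in
/-- The map `(∑ xᵢ ⊗ yᵢ, f) ↦ ∑ xᵢ ⊙ (ȳᵢ ⊗ f)`. -/
def rankTensor : E ⊗[ℂ] Conj E →ₗ[ℂ] F →ₗ[ℂ] InteriorTensor E (dualCorrespondence T) :=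
  TensorProduct.lift <| LinearMap.mk₂ ℂ
    (fun x y ↦ (tmulLin (dualCorrespondence T) x).comp (dualMk E F T (Conj.out y)))
    (fun _ _ _ ↦ by rw [map_add, LinearMap.add_comp])
    (fun _ _ _ ↦ by rw [map_smul, LinearMap.smul_comp])
    (fun _ _ _ ↦ by rw [map_add, map_add, LinearMap.comp_add])
    (fun _ _ _ ↦ by
      rw [LinearMap.map_smulₛₗ, LinearMap.map_smulₛₗ, Complex.conj_conj, LinearMap.comp_smul])

lemma rankTensor_tmul (x y : E) (f : F) :
    rankTensor T (x ⊗ₜ Conj.mk y) f = tmul x (dualMk E F T y f) := rfl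

lemma amplify_one_rankTensor (t : E ⊗[ℂ] Conj E) (f : F) :
    (amplify (dualCorrespondence T) 1).1 (rankTensor T t f) = rankTensor T t f := by
  induction t using finiteRank_induction with
  | zero => simp
  | add s t hs ht => rw [map_add, LinearMap.add_apply, map_add, hs, ht]
  | tmul x y => rw [rankTensor_tmul, amplify_tmul]; rfl

/-- On elementary tensors both sides reduce to `x'⟪x, ay⟫y'*`: on the right this is the product
`(xx'*)* a (yy'*)`, and on the left the left action carries `⟪x, ay⟫` into `ȳ'`. Thus `Ψ(t)f`
behaves like the vector `tΞf` of a dilation before `Ξ` exists. -/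
lemma inner_rankTensor (a : Adjointable Bᵐᵒᵖ E E) (s t : E ⊗[ℂ] Conj E) (f g : F) :
    inner Cᵐᵒᵖ (rankTensor T s f)
      ((amplify (dualCorrespondence T) a).1 (rankTensor T t g)) =
    inner Cᵐᵒᵖ f ((T (star (finiteRank Bᵐᵒᵖ E s) * (a * finiteRank Bᵐᵒᵖ E t))).1 g) := by
  induction s using finiteRank_induction with
  | zero =>
    rw [map_zero, LinearMap.zero_apply, CStarModule.inner_zero_left (A := Cᵐᵒᵖ)
      (E := InteriorTensor E (dualCorrespondence T)), map_zero, star_zero, zero_mul, map_zero]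
    exact CStarModule.inner_zero_right.symm
  | add s s' hs hs' =>
    rw [map_add, LinearMap.add_apply, CStarModule.inner_add_left (A := Cᵐᵒᵖ)
      (E := InteriorTensor E (dualCorrespondence T)), hs, hs', map_add, star_add,
      add_mul, map_add, Submodule.coe_add, _root_.add_apply, CStarModule.inner_add_right]
  | tmul x x' =>
    induction t using finiteRank_induction with
    | zero =>
      rw [map_zero, LinearMap.zero_apply, map_zero, CStarModule.inner_zero_right (A := Cᵐᵒᵖ)
      (E := InteriorTensor E (dualCorrespondence T)), map_zero, mul_zero, mul_zero, map_zero]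
      exact CStarModule.inner_zero_right.symm
    | add t t' ht ht' =>
      rw [map_add, LinearMap.add_apply, map_add, CStarModule.inner_add_right (A := Cᵐᵒᵖ)
      (E := InteriorTensor E (dualCorrespondence T)), ht, ht', map_add,
        mul_add, mul_add, map_add, Submodule.coe_add, _root_.add_apply,
        CStarModule.inner_add_right]
    | tmul y y' =>
      rw [rankTensor_tmul, rankTensor_tmul, amplify_tmul, inner_tmul, leftAction_dualMk,
        inner_dualMk, finiteRank_tmul, finiteRank_tmul, star_rankOne, mul_rankOne,
        rankOne_mul_rankOne, rankOne_smul_smul]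
      rfl

lemma inner_rankTensor_self (t : E ⊗[ℂ] Conj E) (f : F) :
    inner Cᵐᵒᵖ (rankTensor T t f) (rankTensor T t f) =
    inner Cᵐᵒᵖ f ((T (star (finiteRank Bᵐᵒᵖ E t) * finiteRank Bᵐᵒᵖ E t)).1 f) := by
  have := inner_rankTensor (T := T) 1 t t f f
  rwa [amplify_one_rankTensor, one_mul] at this

/-- The squared norm of `Ψ(u₁ - u₂)f` is the norm of `q = ⟪f, T(w*w)f⟫` with `w = u₁ - u₂`.
Strictness gives only `pq = ⟪f, T(w*w)(f⟪f, f⟫)⟫ → 0`, where `p = ⟪f, f⟫`; the bound `q ≤ 4Mp` makes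
this enough. -/
lemma tendsto_rankTensor_sub (hT : IsStrict T) (f : F) :
    Tendsto (fun t : (E ⊗[ℂ] Conj E) × (E ⊗[ℂ] Conj E) ↦ rankTensor T (t.1 - t.2) f)
      (finiteRankUnit Bᵐᵒᵖ E ×ˢ finiteRankUnit Bᵐᵒᵖ E) (𝓝 0) := by
  obtain ⟨M, hM, hTM⟩ := CompletelyPositive.exists_norm_le T
  set p := inner Cᵐᵒᵖ f f with hp
  let w := fun t : (E ⊗[ℂ] Conj E) × (E ⊗[ℂ] Conj E) ↦
    star (finiteRank Bᵐᵒᵖ E (t.1 - t.2)) * finiteRank Bᵐᵒᵖ E (t.1 - t.2)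
  let q := fun t ↦ inner Cᵐᵒᵖ f ((T (w t)).1 f)
  have h1 : Tendsto (fun t ↦ p * q t)
      (finiteRankUnit Bᵐᵒᵖ E ×ˢ finiteRankUnit Bᵐᵒᵖ E) (𝓝 0) := by
    have h2 := hT.tendsto_apply (eventually_norm_star_mul_finiteRank_sub_le (A := Bᵐᵒᵖ) (E := E))
      strictTendsto_star_mul_finiteRank_sub f f f
    have h3 := tendsto_inner (A := Cᵐᵒᵖ) (tendsto_const_nhds (x := f)) h2
    simpa only [Adjointable.map_smul_mod, CStarModule.inner_op_smul_right, map_zero,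
      ZeroMemClass.coe_zero, _root_.zero_apply, CStarModule.inner_zero_right, mul_zero] using h3
  have h4 : ∀ᶠ t in finiteRankUnit Bᵐᵒᵖ E ×ˢ finiteRankUnit Bᵐᵒᵖ E,
      ‖q t‖ ^ 2 ≤ M * 4 * ‖p * q t‖ := by
    filter_upwards [eventually_norm_star_mul_finiteRank_sub_le (A := Bᵐᵒᵖ) (E := E)] with t ht
    have hw : 0 ≤ T (w t) := map_nonneg T (star_mul_self_nonneg _)
    -- The 4 bounds `‖w*w‖`, as `w` is a difference of two contractions.
    have h5 : T (w t) ≤ algebraMap ℝ _ (M * 4) :=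
      (IsSelfAdjoint.of_nonneg hw).le_algebraMap_norm_self.trans
        (algebraMap_mono _ ((hTM _).trans (by gcongr)))
    refine sq_norm_le_of_le_smul (by positivity) (Adjointable.inner_apply_nonneg hw f) ?_
    refine (Adjointable.inner_apply_mono h5 f).trans_eq ?_
    rw [Algebra.algebraMap_eq_smul_one]
    exact CStarModule.inner_smul_right_real
  have h6 : Tendsto (fun t ↦ ‖q t‖ ^ 2)
      (finiteRankUnit Bᵐᵒᵖ E ×ˢ finiteRankUnit Bᵐᵒᵖ E) (𝓝 0) :=
    squeeze_zero' (Eventually.of_forall fun t ↦ by positivity) h4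
      (by simpa using h1.norm.const_mul (M * 4))
  rw [tendsto_zero_iff_norm_tendsto_zero]
  have h7 : ∀ t : (E ⊗[ℂ] Conj E) × (E ⊗[ℂ] Conj E),
      ‖rankTensor T (t.1 - t.2) f‖ = √√(‖q t‖ ^ 2) := fun t ↦ by
    rw [Real.sqrt_sq (norm_nonneg _)]
    refine (CStarModule.norm_eq_sqrt_norm_inner_self (A := Cᵐᵒᵖ) _).trans ?_
    exact congrArg (fun c ↦ √‖c‖) (inner_rankTensor_self (t.1 - t.2) f)
  simpa only [h7, Real.sqrt_zero] using h6.sqrt.sqrt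

lemma exists_tendsto_rankTensor (hT : IsStrict T) :
    ∃ Ξ : F →L[ℂ] InteriorTensor E (dualCorrespondence T), ∀ f,
      Tendsto (fun t ↦ rankTensor T t f) (finiteRankUnit Bᵐᵒᵖ E) (𝓝 (Ξ f)) := by
  have hlim : ∀ f, ∃ z, Tendsto (fun t ↦ rankTensor T t f) (finiteRankUnit Bᵐᵒᵖ E) (𝓝 z) := by
    intro f
    rw [← cauchy_map_iff_exists_tendsto, cauchy_map_iff',
      uniformity_eq_comap_nhds_zero_swapped, tendsto_comap_iff]
    refine (tendsto_rankTensor_sub hT f).congr fun t ↦ ?_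
    rw [map_sub, LinearMap.sub_apply]
    rfl
  choose Ξ hΞ using hlim
  obtain ⟨M, hM, hTM⟩ := CompletelyPositive.exists_norm_le T
  refine ⟨LinearMap.mkContinuous
    { toFun := Ξ
      map_add' := fun f g ↦ tendsto_nhds_unique (hΞ _) (by
        simpa only [map_add] using (hΞ f).add (hΞ g))
      map_smul' := fun c f ↦ tendsto_nhds_unique (hΞ _) (by
        simpa only [map_smul, RingHom.id_apply] using (hΞ f).const_smul c) } √M fun f ↦ ?_, hΞ⟩
  -- Each `u` is a contraction, so `‖Ψ(u)f‖² ≤ M‖f‖²` along the net, and the bound passes to the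
  -- limit.
  refine le_of_tendsto (hΞ f).norm ?_
  filter_upwards [eventually_finiteRankUnit] with t ht
  refine (pow_le_pow_iff_left₀ (norm_nonneg _) (by positivity) two_ne_zero).mp ?_
  rw [CStarModule.norm_sq_eq Cᵐᵒᵖ, inner_rankTensor_self, mul_pow, Real.sq_sqrt hM.le]
  set w := finiteRank Bᵐᵒᵖ E t
  have h1 : ‖T (star w * w)‖ ≤ M := by
    refine (hTM _).trans (mul_le_of_le_one_right hM.le ?_)
    rw [CStarRing.norm_star_mul_self]
    exact mul_le_one₀ ht.2 (norm_nonneg _) ht.2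
  calc _ ≤ ‖f‖ * ‖(T (star w * w)).1 f‖ := CStarModule.norm_inner_le F
    _ ≤ ‖f‖ * (M * ‖f‖) := by
        gcongr
        exact ((T (star w * w)).1.le_opNorm f).trans (by gcongr; exact h1)
    _ = _ := by ring

/-- If `Ξ f = lim Ψ(u) f` along the finite-rank approximate unit, then
`⟪Ξ f, (a ⊙ id) Ψ(s) g⟫ = ⟪f, T (a s) g⟫` for `s` of finite rank. -/
lemma inner_lim_rankTensor {f : F} {z : InteriorTensor E (dualCorrespondence T)}
    (hz : Tendsto (fun t ↦ rankTensor T t f) (finiteRankUnit Bᵐᵒᵖ E) (𝓝 z))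
    (a : Adjointable Bᵐᵒᵖ E E) (s : E ⊗[ℂ] Conj E) (g : F) :
    inner Cᵐᵒᵖ z ((amplify (dualCorrespondence T) a).1 (rankTensor T s g)) =
      inner Cᵐᵒᵖ f ((T (a * finiteRank Bᵐᵒᵖ E s)).1 g) := by
  obtain ⟨M, hM, hTM⟩ := CompletelyPositive.exists_norm_le T
  refine tendsto_nhds_unique (tendsto_inner hz tendsto_const_nhds) ?_
  simp only [inner_rankTensor]
  refine tendsto_inner tendsto_const_nhds ?_
  -- Since `as` is compact, `u(as) → as` in norm, and norm continuity of `T` suffices; strictness of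
  -- `T` is not needed at this point.
  have h1 := (strictTendsto_mul_finiteRank (1 : Adjointable Bᵐᵒᵖ E E) _ (mul_finiteRank_mem a s)).1
  simp only [one_mul] at h1
  have h2 : Tendsto (fun t ↦ star (finiteRank Bᵐᵒᵖ E t) * (a * finiteRank Bᵐᵒᵖ E s))
      (finiteRankUnit Bᵐᵒᵖ E) (𝓝 (a * finiteRank Bᵐᵒᵖ E s)) := by
    refine h1.congr' ?_
    filter_upwards [eventually_finiteRankUnit] with t ht
    rw [ht.1.star_eq]
  let ev : Adjointable Cᵐᵒᵖ F F →L[ℂ] F :=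
    (ContinuousLinearMap.apply ℂ F g).comp (Adjointable Cᵐᵒᵖ F F).subtypeL
  exact (ev.continuous.tendsto _).comp (((map_continuous T).tendsto _).comp h2)

end Main

end HilbertCStar

end

/-- Every strict CP-map `T : 𝓑ᵃ(E) → 𝓑ᵃ(F)` is of the form `T = Ξ* (• ⊙ id_𝓕) Ξ`. -/
theorem mainTheorem4 {B : Type u} [NonUnitalCStarAlgebra B] [PartialOrder B] [StarOrderedRing B]
    {C : Type v} [NonUnitalCStarAlgebra C] [PartialOrder C] [StarOrderedRing C]
    {E : Type w} [NormedAddCommGroup E] [NormedSpace ℂ E] [SMul Bᵐᵒᵖ E] [CStarModule Bᵐᵒᵖ E]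
    [CompleteSpace E]
    {F : Type w'} [NormedAddCommGroup F] [NormedSpace ℂ F] [SMul Cᵐᵒᵖ F] [CStarModule Cᵐᵒᵖ F]
    [CompleteSpace F]
    (T : Adjointable Bᵐᵒᵖ E E →CP Adjointable Cᵐᵒᵖ F F)
    (hT : IsStrict T) :
    ∃ (𝓕 : Correspondence.{u, v, max w w'} B C)
      (Ξ : Adjointable Cᵐᵒᵖ F (InteriorTensor E 𝓕)),
      ∀ a : Adjointable Bᵐᵒᵖ E E,
        (T a).1 = (Adjointable.adj Ξ).1 ∘L (amplify 𝓕 a).1 ∘L Ξ.1 := by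
  obtain ⟨Ξ₀, hΞ₀⟩ := exists_tendsto_rankTensor hT
  let Ξ : Adjointable Cᵐᵒᵖ F (InteriorTensor E (dualCorrespondence T)) :=
    -- The adjoint sends `x ⊙ (ȳ ⊗ g)` to `T(xy*)g`.
    ⟨Ξ₀, mem_adjointable_of_dense Ξ₀ _ dense_span_tmul_dualMk (by
      rintro _ ⟨x, y, g, rfl⟩
      refine ⟨(T (rankOne Bᵐᵒᵖ x y)).1 g, fun f ↦ ?_⟩
      rw [← rankTensor_tmul, ← amplify_one_rankTensor, inner_lim_rankTensor (hΞ₀ f), one_mul,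
        finiteRank_tmul])⟩
  refine ⟨dualCorrespondence T, Ξ, fun a ↦ ContinuousLinearMap.ext fun g ↦ ?_⟩
  set S : F →L[ℂ] F := (Adjointable.adj Ξ).1 ∘L (amplify (dualCorrespondence T) a).1 ∘L Ξ.1
    with hS
  have hSsmul : ∀ (c : Cᵐᵒᵖ) (g : F), S (c • g) = c • S g := fun c g ↦ by
    simp only [hS, ContinuousLinearMap.comp_apply, Adjointable.map_smul_mod]
  -- The second `Ξ₀` is expanded as a limit, giving `⟪f, T(au)(x⟪y, z⟫)⟫` along the net; strictness
  -- applies because `au → a` strictly with bound `‖a‖`.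
  have hcompact : ∀ x y z : F,
      S (inner Cᵐᵒᵖ y z • x) = (T a).1 (inner Cᵐᵒᵖ y z • x) := fun x y z ↦ by
    refine ext_inner_left (A := Cᵐᵒᵖ) fun f ↦ ?_
    have h1 : inner Cᵐᵒᵖ f (S (inner Cᵐᵒᵖ y z • x)) = inner Cᵐᵒᵖ (Ξ₀ f)
        ((amplify (dualCorrespondence T) a).1 (Ξ₀ (inner Cᵐᵒᵖ y z • x))) :=
      Adjointable.inner_adj_right _ _ _
    rw [h1]
    refine tendsto_nhds_unique (tendsto_inner tendsto_const_nhds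
      (((amplify (dualCorrespondence T) a).1.continuous.tendsto _).comp (hΞ₀ _))) ?_
    simp only [Function.comp_def, inner_lim_rankTensor (hΞ₀ f)]
    exact tendsto_inner tendsto_const_nhds (hT.tendsto_apply
      (eventually_norm_mul_finiteRank_le a) (strictTendsto_mul_finiteRank a) x y z)
  refine (sub_eq_zero.mp (eq_zero_of_inner_smul_self_eq_zero (A := Cᵐᵒᵖ) ?_)).symm
  -- Taking `y = z = d` in `hcompact`, and using that `S` and `T a` are module maps, gives `d⟪d, d⟫
  -- = 0`.
  set d := S g - (T a).1 g
  have h := hcompact g d d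
  rw [hSsmul, Adjointable.map_smul_mod] at h
  have hsub : ∀ c : Cᵐᵒᵖ, c • d = c • S g - c • (T a).1 g :=
    fun c ↦ map_sub (smulLin F c) _ _
  rw [hsub, h, sub_self]
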